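/- Let $\alpha\in(0,1/3)$, $p_1=(0,0)$, $p_2=(\tfrac12,\tfrac{\sqrt3}2)$, $p_3=(1,0)$, $p_4=\tfrac{p_2+p_3}2$, $p_5=\tfrac{p_1+p_3}2$, $p_6=\tfrac{p_1+p_2}2$, and $G_i(x)=A_i(x-p_i)+p_i$ on $\mathbb R^2$, where $A_1=A_2=A_3=\tfrac{1-\alpha}2 I_2$ and $$A_4=\tfrac\alpha4\begin{pmatrix}1&-\sqrt3\\-\sqrt3&3\end{pmatrix},\quad A_5=\alpha\begin{pmatrix}1&0\\0&0\end{pmatrix},\quad A_6=\tfrac\alpha4\begin{pmatrix}1&\sqrt3\\\sqrt3&3\end{pmatrix}.$$ Let $K_\alpha$ (the Hanoi attractor) be the unique nonempty compact set with $K_\alpha=\bigcup_{i=1}^6G_i(K_\alpha)$. For a word $w=w_1\cdots w_n$ in the letters $1,2,3$ put $G_w=G_{w_1}\circ\dots\circ G_{w_n}$. For $\{i,j,k\}=\{1,2,3\}$ let $e_i$ be the open segment joining $G_j(p_k)$ and $G_k(p_j)$. Let $\mathcal J_n$ be the set of the segments $e=G_w(e_i)$ with $|w|<n$ and $i\in\{1,2,3\}$,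 let $W_n=\bigcup_{|w|=n}G_w(\{p_1,p_2,p_3\})$, $V_n=W_n\cup\bigcup_{e\in\mathcal J_n}e$ and $V_*=\bigcup_nV_n\subseteq K_\alpha$. For $e\in\mathcal J_n$ with end points $a_e,b_e$ (which lie in $W_n$) put $\varphi_e(t)=(b_e-a_e)t+a_e$, $t\in[0,1]$. Let $\mathcal D_n$ be the set of all $u\colon V_n\to\mathbb R$ such that, for every $e\in\mathcal J_n$, the function $u\circ\varphi_e$ on the closed interval $[0,1]$ is (the continuous representative of) a function of the Sobolev space $H^1(0,1)$. With $d_k=\alpha(\tfrac{1-\alpha}2)^{k-1}$, $\rho_n^d=\prod_{k=1}^n\frac3{5+3d_k}$ and $\rho_k^c=\rho_{k-1}^d\,\frac{3d_k}{5+3d_k}$, let $$\mathcal E_n[u]=\frac1{\rho_n^d}\sum_{x\sim_n y}(u(x)-u(y))^2+\sum_{k=1}^n\frac1{\rho_k^c}\sum_{e\in\mathcal J_k\setminus\mathcal J_{k-1}}\int_0^1|(u\circ\varphi_e)'|^2\,dt,\qquad u\in\mathcal D_n,$$ where the first sum is over the unordered pairs of distinct points lying in a common set $G_w(\{p_1,p_2,p_3\})$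 with $|w|=n$. Let $\mathcal F$ be the set of all continuous $u\colon K_\alpha\to\mathbb R$ with $u|_{V_n}\in\mathcal D_n$ for all $n$ for which $\lim_n\mathcal E_n[u|_{V_n}]$ exists and is finite; put $\mathcal E[u]=\lim_n\mathcal E_n[u|_{V_n}]$ and $\mathcal E(u,v)=\frac12(\mathcal E[u+v]-\mathcal E[u]-\mathcal E[v])$. Recall that a pair $(E,F)$ is a resistance form on a set $X$ if: (R1) $F$ is a linear space of functions $X\to\mathbb R$ containing the constants and $E$ is a non-negative symmetric bilinear form on $F$ with $E(u,u)=0$ exactly for constant $u$; (R2) $F$ modulo constants is complete for the distance $E(u-v,u-v)^{1/2}$; (R3) $F$ separates the points of $X$; (R4) $R(x,y)=\sup\{|u(x)-u(y)|^2/E(u,u): u\in F,\ E(u,u)>0\}<\infty$ for all $x,y\in X$ (with $\sup\emptyset=0$); (R5) for $u\in F$, $\bar u=\min(\max(u,0),1)\in F$ and $E(\bar u,\bar u)\le E(u,u)$. Its resistance metric is $R$. It is regular if $F\cap C_0(X)$ is dense in $C_0(X)$ in the supremum norm, where $C_0(X)$ is the set of continuous compactly supported real functions on $X$ for the topology of $R$.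 Then $(\mathcal E,\mathcal F)$ is a resistance form on $K_\alpha$; its resistance metric and the Euclidean metric induce the same topology on $K_\alpha$, so that $K_\alpha$ is compact for the resistance metric; and the resistance form $(\mathcal E,\mathcal F)$ is regular. -/

import Mathlib

open Set Filter Topology MeasureTheory Metric

noncomputable section

/-! ### Resistance forms -/

/-- The quotients `|u x - u y|² / E(u,u)` whose supremum is the effective resistance between `x`
and `y`. Functions of zero energy (the constants, for a resistance form) carry no information
and are left out. -/
def resistanceQuotients {X : Type*} (F : Set (X → ℝ)) (E : (X → ℝ) → (X → ℝ) → ℝ) (x y : X) :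
    Set ℝ :=
  {r | ∃ u ∈ F, 0 < E u u ∧ r = |u x - u y| ^ 2 / E u u}

/-- A resistance form `(E, F)` on `X`. -/
structure IsResistanceForm {X : Type*} (F : Set (X → ℝ)) (E : (X → ℝ) → (X → ℝ) → ℝ) : Prop where
  /-- (R1): `F` is a linear space of functions that contains the constants. -/
  const_mem : ∀ c : ℝ, (fun _ => c) ∈ F
  add_mem : ∀ u ∈ F, ∀ v ∈ F, u + v ∈ F
  smul_mem : ∀ c : ℝ, ∀ u ∈ F, c • u ∈ F
  /-- (R1): `E` is a symmetric non-negative bilinear form on `F`, vanishing on the diagonal exactly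
  at the constants. -/
  add_left : ∀ u ∈ F, ∀ v ∈ F, ∀ w ∈ F, E (u + v) w = E u w + E v w
  smul_left : ∀ c : ℝ, ∀ u ∈ F, ∀ v ∈ F, E (c • u) v = c * E u v
  symm : ∀ u ∈ F, ∀ v ∈ F, E u v = E v u
  nonneg : ∀ u ∈ F, 0 ≤ E u u
  eq_zero_iff : ∀ u ∈ F, (E u u = 0 ↔ ∃ c : ℝ, u = fun _ => c)
  /-- (R2): `F` modulo constants is complete for the distance `E(u - v, u - v) ^ (1/2)`. -/
  complete : ∀ u : ℕ → X → ℝ, (∀ n, u n ∈ F) →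
    (∀ ε > 0, ∃ N, ∀ m ≥ N, ∀ n ≥ N, √(E (u m - u n) (u m - u n)) < ε) →
    ∃ v ∈ F, Tendsto (fun n => √(E (u n - v) (u n - v))) atTop (𝓝 0)
  /-- (R3): `F` separates points. -/
  separates : ∀ x y : X, x ≠ y → ∃ u ∈ F, u x ≠ u y
  /-- (R4): effective resistances are finite. -/
  bddAbove : ∀ x y : X, BddAbove (resistanceQuotients F E x y)
  /-- (R5): the Markov property. -/
  markov : ∀ u ∈ F, (fun x => min (max (u x) 0) 1) ∈ F ∧
    E (fun x => min (max (u x) 0) 1) (fun x => min (max (u x) 0) 1) ≤ E u u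

/-- The resistance metric `R(x, y)`. -/
def resistanceMetric {X : Type*} (F : Set (X → ℝ)) (E : (X → ℝ) → (X → ℝ) → ℝ) (x y : X) : ℝ :=
  sSup (resistanceQuotients F E x y)

/-- The topology of the resistance metric: a set is open if with each of its points it contains
an `R`-ball about that point. -/
@[reducible] def resistanceTopology {X : Type*} (F : Set (X → ℝ))
    (E : (X → ℝ) → (X → ℝ) → ℝ) : TopologicalSpace X where
  IsOpen U := ∀ x ∈ U, ∃ ε > 0, ∀ y, resistanceMetric F E x y < ε → y ∈ U
  isOpen_univ := fun _ _ => ⟨1, one_pos, fun _ _ => mem_univ _⟩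
  isOpen_inter := by
    rintro U V hU hV x ⟨hxU, hxV⟩
    obtain ⟨ε, hε, h⟩ := hU x hxU
    obtain ⟨δ, hδ, h'⟩ := hV x hxV
    exact ⟨min ε δ, lt_min hε hδ, fun y hy =>
      ⟨h y (hy.trans_le (min_le_left _ _)), h' y (hy.trans_le (min_le_right _ _))⟩⟩
  isOpen_sUnion := by
    rintro S hS x ⟨U, hU, hx⟩
    obtain ⟨ε, hε, h⟩ := hS U hU x hx
    exact ⟨ε, hε, fun y hy => ⟨U, hU, h y hy⟩⟩

/-- The space `C₀(X)` of continuous functions with compact support, both with respect to the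
topology of the resistance metric. -/
def resistanceC0 {X : Type*} (F : Set (X → ℝ)) (E : (X → ℝ) → (X → ℝ) → ℝ) : Set (X → ℝ) :=
  letI : TopologicalSpace X := resistanceTopology F E
  {f | Continuous f ∧ HasCompactSupport f}

/-- Regularity of a resistance form: `F ∩ C₀(X)` is dense in `C₀(X)` for the supremum norm. -/
def IsRegularForm {X : Type*} (F : Set (X → ℝ)) (E : (X → ℝ) → (X → ℝ) → ℝ) : Prop :=
  ∀ f ∈ resistanceC0 F E, ∀ ε > 0, ∃ g ∈ F ∩ resistanceC0 F E, ∀ x, |f x - g x| < ε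

/-! ### The Hanoi attractor

The indices `1, …, 6` of the points and contractions are shifted to `0, …, 5`, and the alphabet
`{1, 2, 3}` to `{0, 1, 2}`. -/

namespace Hanoi

abbrev Plane : Type := EuclideanSpace ℝ (Fin 2)

/-- The vertices of the equilateral triangle and the midpoints of its sides. -/
def point : Fin 6 → Plane :=
  ![!₂[0, 0], !₂[1 / 2, √3 / 2], !₂[1, 0],
    !₂[3 / 4, √3 / 4], !₂[1 / 2, 0], !₂[1 / 4, √3 / 4]]

def linearPart (α : ℝ) : Fin 6 → Matrix (Fin 2) (Fin 2) ℝ :=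
  ![((1 - α) / 2) • 1, ((1 - α) / 2) • 1, ((1 - α) / 2) • 1,
    (α / 4) • !![1, -√3; -√3, 3], α • !![1, 0; 0, 0], (α / 4) • !![1, √3; √3, 3]]

/-- The contractions `x ↦ Aᵢ (x - pᵢ) + pᵢ`. -/
def contraction (α : ℝ) (i : Fin 6) (x : Plane) : Plane :=
  Matrix.toEuclideanLin (linearPart α i) (x - point i) + point i

theorem contraction_lipschitz {α : ℝ} (hα : α ∈ Ioo (0 : ℝ) (1 / 3)) (i : Fin 6) :
    LipschitzWith (1 / 2) (contraction α i) := by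
  obtain ⟨h0, h1⟩ := hα
  have h3 : √3 * √3 = 3 := Real.mul_self_sqrt (by norm_num)
  refine LipschitzWith.of_dist_le_mul fun x y => ?_
  rw [dist_eq_norm, dist_eq_norm]
  have : contraction α i x - contraction α i y = Matrix.toEuclideanLin (linearPart α i) (x - y) := by
    simp only [contraction, add_sub_add_right_eq_sub, ← map_sub, sub_sub_sub_cancel_right]
  rw [this]
  generalize x - y = v
  apply le_of_sq_le_sq _ (by positivity)
  rw [mul_pow, EuclideanSpace.real_norm_sq_eq, EuclideanSpace.real_norm_sq_eq]
  have hα2 : α ^ 2 ≤ 1 / 4 := by nlinarith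
  have hb2 : ((1 - α) / 2) ^ 2 ≤ 1 / 4 := by nlinarith
  have key : ∀ a b : ℝ, a ^ 2 ≤ 1 / 4 → 0 ≤ b → a ^ 2 * b ≤ 1 / 4 * b :=
    fun a b h hb => mul_le_mul_of_nonneg_right h hb
  have e1 := key ((1 - α) / 2) (v 0 ^ 2 + v 1 ^ 2) hb2 (by positivity)
  have e2 := key α (v 0 ^ 2 + v 1 ^ 2) hα2 (by positivity)
  have e3 : α ^ 2 * ((v 0 - √3 * v 1) ^ 2 / 4) ≤ α ^ 2 * (v 0 ^ 2 + v 1 ^ 2) :=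
    mul_le_mul_of_nonneg_left (by nlinarith [sq_nonneg (√3 * v 0 + v 1)]) (sq_nonneg _)
  have e4 : α ^ 2 * ((v 0 + √3 * v 1) ^ 2 / 4) ≤ α ^ 2 * (v 0 ^ 2 + v 1 ^ 2) :=
    mul_le_mul_of_nonneg_left (by nlinarith [sq_nonneg (√3 * v 0 - v 1)]) (sq_nonneg _)
  have e5 : α ^ 2 * v 0 ^ 2 ≤ α ^ 2 * (v 0 ^ 2 + v 1 ^ 2) :=
    mul_le_mul_of_nonneg_left (by nlinarith [sq_nonneg (v 1)]) (sq_nonneg _)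
  have hq : ((((1 / 2 : NNReal)) : ℝ)) ^ 2 = 1 / 4 := by norm_num
  rw [hq]
  have h4 : √3 ^ 2 = 3 := by rw [sq, h3]
  fin_cases i <;>
    simp [linearPart, Matrix.toEuclideanLin, Matrix.toLpLin_apply, Fin.sum_univ_two,
      dotProduct]
  · nlinarith
  · nlinarith
  · nlinarith
  · have : (α / 4 * v 0 + -(α / 4 * √3 * v 1)) ^ 2 + (-(α / 4 * √3 * v 0) + α / 4 * 3 * v 1) ^ 2
        = α ^ 2 * ((v 0 - √3 * v 1) ^ 2 / 4) := by
      linear_combination (α ^ 2 / 16 * v 0 ^ 2 - 3 * α ^ 2 / 16 * v 1 ^ 2) * h4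
    linarith
  · nlinarith
  · have : (α / 4 * v 0 + (α / 4 * √3 * v 1)) ^ 2 + ((α / 4 * √3 * v 0) + α / 4 * 3 * v 1) ^ 2
        = α ^ 2 * ((v 0 + √3 * v 1) ^ 2 / 4) := by
      linear_combination (α ^ 2 / 16 * v 0 ^ 2 - 3 * α ^ 2 / 16 * v 1 ^ 2) * h4
    linarith

theorem existsUnique_attractor {α : ℝ} (hα : α ∈ Ioo (0 : ℝ) (1 / 3)) :
    ∃! K : TopologicalSpace.NonemptyCompacts Plane,
      (K : Set Plane) = ⋃ i, contraction α i '' (K : Set Plane) := by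
  let T : TopologicalSpace.NonemptyCompacts Plane → TopologicalSpace.NonemptyCompacts Plane :=
    fun K => ⟨⟨⋃ i, contraction α i '' (K : Set Plane),
      isCompact_iUnion fun i => K.isCompact.image (contraction_lipschitz hα i).continuous⟩,
      nonempty_iUnion.2 ⟨0, K.nonempty.image _⟩⟩
  have hT : ContractingWith (1 / 2) T := by
    refine ⟨NNReal.half_lt_self one_ne_zero, fun K L => ?_⟩
    change hausdorffEDist (⋃ i, contraction α i '' (K : Set Plane))
      (⋃ i, contraction α i '' (L : Set Plane)) ≤ _ * hausdorffEDist (K : Set Plane) L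
    refine hausdorffEDist_iUnion_le.trans (iSup_le fun i => ?_)
    have aux : ∀ A B : TopologicalSpace.NonemptyCompacts Plane, ∀ x ∈ contraction α i '' (A : Set Plane),
        infEDist x (contraction α i '' (B : Set Plane)) ≤
          ((1 / 2 : NNReal) : ENNReal) * hausdorffEDist (A : Set Plane) B := by
      rintro A B _ ⟨x, hx, rfl⟩
      obtain ⟨y, hy, hxy⟩ := B.isCompact.exists_infEDist_eq_edist B.nonempty x
      refine (infEDist_le_edist_of_mem (mem_image_of_mem _ hy)).trans
        ((contraction_lipschitz hα i x y).trans ?_)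
      rw [← hxy]
      gcongr
      exact infEDist_le_hausdorffEDist_of_mem hx
    refine hausdorffEDist_le_of_infEDist (aux K L) fun x hx => ?_
    rw [hausdorffEDist_comm]
    exact aux L K x hx
  have : Nonempty (TopologicalSpace.NonemptyCompacts Plane) := ⟨{0}⟩
  refine ⟨hT.fixedPoint T, ?_, fun L hL => ?_⟩
  · exact (congrArg (fun K : TopologicalSpace.NonemptyCompacts Plane => (K : Set Plane))
      hT.fixedPoint_isFixedPt).symm
  · exact hT.fixedPoint_unique (TopologicalSpace.NonemptyCompacts.ext hL.symm)

/-- The Hanoi attractor `K_α`: the unique nonempty compact set with `K = ⋃ᵢ Gᵢ(K)`. -/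
def attractor {α : ℝ} (hα : α ∈ Ioo (0 : ℝ) (1 / 3)) : Set Plane :=
  ((existsUnique_attractor hα).choose : Set Plane)

/-- The letter `i` of the alphabet, as an index of a vertex or contraction. -/
abbrev letter (i : Fin 3) : Fin 6 := Fin.castAdd 3 i

/-- `G_w = G_{w₁} ∘ ⋯ ∘ G_{wₙ}` for a word `w` of length `n`. -/
def wordMap (α : ℝ) : {n : ℕ} → (Fin n → Fin 3) → Plane → Plane
  | 0, _ => id
  | _ + 1, w => contraction α (letter (w 0)) ∘ wordMap α (Fin.tail w)

/-- Initial point of the segment `e_i`, namely `G_j(p_k)` where `j = i + 1`, `k = i + 2` mod 3. -/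
def segStart (α : ℝ) (i : Fin 3) : Plane := contraction α (letter (i + 1)) (point (letter (i + 2)))

/-- End point of the segment `e_i`, namely `G_k(p_j)` where `j = i + 1`, `k = i + 2` mod 3. -/
def segEnd (α : ℝ) (i : Fin 3) : Plane := contraction α (letter (i + 2)) (point (letter (i + 1)))

/-- `W_n`, the vertices of the triangles of level `n`. -/
def W (α : ℝ) (n : ℕ) : Set Plane :=
  ⋃ w : Fin n → Fin 3, wordMap α w '' range fun j : Fin 3 => point (letter j)

/-- `J_n`, the union of the open segments `G_w(e_i)` over the words `w` of length less than `n`. -/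
def J (α : ℝ) (n : ℕ) : Set Plane :=
  ⋃ m ∈ Finset.range n, ⋃ w : Fin m → Fin 3,
    wordMap α w '' ⋃ i, openSegment ℝ (segStart α i) (segEnd α i)

def V (α : ℝ) (n : ℕ) : Set Plane := W α n ∪ J α n

def Vstar (α : ℝ) : Set Plane := ⋃ n, V α n

/-- The parametrization `φ_e(t) = (b_e - a_e) t + a_e` of the segment `e = G_w(e_i)`, with
`a_e = G_w(segStart i)` and `b_e = G_w(segEnd i)`. -/
def path (α : ℝ) {m : ℕ} (w : Fin m → Fin 3) (i : Fin 3) (t : ℝ) : Plane :=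
  t • (wordMap α w (segEnd α i) - wordMap α w (segStart α i)) + wordMap α w (segStart α i)

theorem contraction_point (α : ℝ) (i : Fin 6) : contraction α i (point i) = point i := by
  simp [contraction]

theorem contraction_combo (α : ℝ) (i : Fin 6) (a b : Plane) (t : ℝ) :
    contraction α i (t • (b - a) + a) =
      t • (contraction α i b - contraction α i a) + contraction α i a := by
  simp only [contraction, map_sub, map_add, map_smul]
  module

theorem wordMap_combo (α : ℝ) (a b : Plane) (t : ℝ) : ∀ {n : ℕ} (w : Fin n → Fin 3),
    wordMap α w (t • (b - a) + a) = t • (wordMap α w b - wordMap α w a) + wordMap α w a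
  | 0, _ => rfl
  | n + 1, w => by
    simp only [wordMap, Function.comp_apply, wordMap_combo α a b t (Fin.tail w),
      contraction_combo]

theorem wordMap_contraction (α : ℝ) (j : Fin 3) (x : Plane) : ∀ {n : ℕ} (w : Fin n → Fin 3),
    ∃ w' : Fin (n + 1) → Fin 3, wordMap α w (contraction α (letter j) x) = wordMap α w' x
  | 0, _ => ⟨fun _ => j, rfl⟩
  | n + 1, w => by
    obtain ⟨v, hv⟩ := wordMap_contraction α j x (Fin.tail w)
    exact ⟨Fin.cons (w 0) v, by simp [wordMap, hv]⟩

theorem wordMap_point_mem_W (α : ℝ) {n : ℕ} (w : Fin n → Fin 3) (j : Fin 3) :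
    wordMap α w (point (letter j)) ∈ W α n :=
  mem_iUnion.2 ⟨w, mem_image_of_mem _ ⟨j, rfl⟩⟩

theorem wordMap_point_mem_V (α : ℝ) {n : ℕ} (w : Fin n → Fin 3) (j : Fin 3) :
    wordMap α w (point (letter j)) ∈ V α n :=
  Or.inl (wordMap_point_mem_W α w j)

theorem W_mono (α : ℝ) : Monotone (W α) := by
  refine monotone_nat_of_le_succ fun n x hx => ?_
  obtain ⟨w, hx⟩ := mem_iUnion.1 hx
  obtain ⟨_, ⟨j, rfl⟩, rfl⟩ := hx
  obtain ⟨w', hw'⟩ := wordMap_contraction α j (point (letter j)) w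
  rw [contraction_point] at hw'
  change wordMap α w (point (letter j)) ∈ _
  rw [hw']
  exact wordMap_point_mem_W α w' j

theorem path_mem_V (α : ℝ) {m n : ℕ} (h : m < n) (w : Fin m → Fin 3) (i : Fin 3)
    (t : Icc (0 : ℝ) 1) : path α w i t ∈ V α n := by
  obtain ⟨t, h0, h1⟩ := t
  simp only [path]
  rcases h0.eq_or_lt with rfl | h0
  · obtain ⟨w', hw'⟩ := wordMap_contraction α (i + 1) (point (letter (i + 2))) w
    left
    rw [zero_smul, zero_add, segStart, hw']
    exact W_mono α h (wordMap_point_mem_W α w' _)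
  rcases h1.eq_or_lt with rfl | h1
  · obtain ⟨w', hw'⟩ := wordMap_contraction α (i + 2) (point (letter (i + 1))) w
    left
    rw [one_smul, sub_add_cancel, segEnd, hw']
    exact W_mono α h (wordMap_point_mem_W α w' _)
  · right
    simp only [J, mem_iUnion]
    refine ⟨m, Finset.mem_range.2 h, w, t • (segEnd α i - segStart α i) + segStart α i,
      mem_iUnion.2 ⟨i, ?_⟩, wordMap_combo α _ _ t w⟩
    rw [openSegment_eq_image_lineMap]
    exact ⟨t, ⟨h0, h1⟩, AffineMap.lineMap_apply_module' _ _ _⟩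

section Attractor

variable {α : ℝ} (hα : α ∈ Ioo (0 : ℝ) (1 / 3))

theorem attractor_isCompact : IsCompact (attractor hα) := (existsUnique_attractor hα).choose.isCompact

theorem attractor_nonempty : (attractor hα).Nonempty := (existsUnique_attractor hα).choose.nonempty

theorem attractor_eq : attractor hα = ⋃ i, contraction α i '' attractor hα :=
  (existsUnique_attractor hα).choose_spec.1

theorem contraction_mem {x : Plane} (hx : x ∈ attractor hα) (i : Fin 6) :
    contraction α i x ∈ attractor hα := by
  rw [attractor_eq hα]
  exact mem_iUnion.2 ⟨i, mem_image_of_mem _ hx⟩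

theorem wordMap_mem {x : Plane} (hx : x ∈ attractor hα) : ∀ {n : ℕ} (w : Fin n → Fin 3),
    wordMap α w x ∈ attractor hα
  | 0, _ => hx
  | _ + 1, w => contraction_mem hα (wordMap_mem hx (Fin.tail w)) _

theorem point_mem (i : Fin 6) : point i ∈ attractor hα := by
  obtain ⟨x, hx⟩ := attractor_nonempty hα
  have hc : ContractingWith (1 / 2) (contraction α i) :=
    ⟨NNReal.half_lt_self one_ne_zero, contraction_lipschitz hα i⟩
  have hl := hc.tendsto_iterate_fixedPoint x
  rw [← hc.fixedPoint_unique (contraction_point α i)] at hl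
  refine (attractor_isCompact hα).isClosed.mem_of_tendsto hl (Eventually.of_forall fun n => ?_)
  induction n with
  | zero => exact hx
  | succ n ih => rw [Function.iterate_succ_apply']; exact contraction_mem hα ih i

/-- The coordinate along the side opposite to the `i`-th vertex. -/
def sideCoord (i : Fin 3) (x : Plane) : ℝ :=
  ![((x 0 - 1 / 2) - √3 * (x 1 - √3 / 2)) / 2, 1 - x 0, (x 0 + √3 * x 1) / 2] i

theorem contraction_side (α : ℝ) (i : Fin 3) (x : Plane) :
    contraction α (Fin.natAdd 3 i) x =
      sideCoord i x • (segEnd α i - segStart α i) + segStart α i := by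
  have h4 : √3 ^ 2 = 3 := Real.sq_sqrt (by norm_num)
  ext k
  fin_cases i <;> fin_cases k <;>
    simp [sideCoord, segEnd, segStart, contraction, point, linearPart, letter, Matrix.vecHead,
      Matrix.vecTail, Matrix.toEuclideanLin, Matrix.toLpLin_apply] <;>
    grind

theorem sideCoord_fst (α : ℝ) (i : Fin 3) (x : Plane) :
    sideCoord i (contraction α (letter (i + 1)) x) = (1 - α) / 2 * sideCoord i x := by
  have h4 : √3 ^ 2 = 3 := Real.sq_sqrt (by norm_num)
  fin_cases i <;>
    simp [sideCoord, contraction, point, linearPart, letter, Matrix.toEuclideanLin] <;>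
    grind

theorem sideCoord_snd (α : ℝ) (i : Fin 3) (x : Plane) :
    sideCoord i (contraction α (letter (i + 2)) x) = 1 - (1 - α) / 2 * (1 - sideCoord i x) := by
  have h4 : √3 ^ 2 = 3 := Real.sq_sqrt (by norm_num)
  fin_cases i <;>
    simp [sideCoord, contraction, point, linearPart, letter, Matrix.toEuclideanLin] <;>
    grind

theorem sideCoord_mid (α : ℝ) (i : Fin 3) (x : Plane) :
    sideCoord i (contraction α (Fin.natAdd 3 i) x) = 1 / 2 + α * (sideCoord i x - 1 / 2) := by
  have h4 : √3 ^ 2 = 3 := Real.sq_sqrt (by norm_num)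
  fin_cases i <;>
    simp [sideCoord, contraction, point, linearPart, Matrix.vecHead, Matrix.vecTail,
      Matrix.toEuclideanLin, Matrix.toLpLin_apply] <;>
    grind

theorem exists_sideCoord_eq (i : Fin 3) {t : ℝ} (ht : t ∈ Icc (0 : ℝ) 1) :
    ∃ x ∈ attractor hα, sideCoord i x = t := by
  have hcont : Continuous (sideCoord i) := by
    fin_cases i
    · change Continuous fun x : Plane => ((x 0 - 1 / 2) - √3 * (x 1 - √3 / 2)) / 2
      fun_prop
    · change Continuous fun x : Plane => 1 - x 0
      fun_prop
    · change Continuous fun x : Plane => (x 0 + √3 * x 1) / 2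
      fun_prop
  have hcl : IsClosed (sideCoord i '' attractor hα) :=
    ((attractor_isCompact hα).image hcont).isClosed
  obtain ⟨x₀, hx₀⟩ := attractor_nonempty hα
  have happrox : ∀ n : ℕ, ∀ t ∈ Icc (0 : ℝ) 1, ∃ x ∈ attractor hα,
      |sideCoord i x - t| ≤ (1 / 2) ^ n * (|sideCoord i x₀| + 1) := by
    have h0 := hα.1
    have h1 := hα.2
    intro n
    induction n with
    | zero =>
      intro t ht
      refine ⟨x₀, hx₀, ?_⟩
      have := abs_sub (sideCoord i x₀) t
      rw [abs_of_nonneg ht.1] at this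
      linarith [ht.2]
    | succ n ih =>
      intro t ht
      set C := |sideCoord i x₀| + 1
      have step : ∀ c d : ℝ, 0 < c → c ≤ 1 / 2 → (t - d) / c ∈ Icc (0 : ℝ) 1 →
          ∀ j : Fin 6, (∀ x, sideCoord i (contraction α j x) = d + c * sideCoord i x) →
          ∃ x ∈ attractor hα, |sideCoord i x - t| ≤ (1 / 2) ^ (n + 1) * C := by
        intro c d hc hc2 hm j hj
        obtain ⟨x, hx, hxt⟩ := ih _ hm
        refine ⟨_, contraction_mem hα hx j, ?_⟩
        rw [hj, show d + c * sideCoord i x - t = c * (sideCoord i x - (t - d) / c) by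
          field_simp; ring, abs_mul, abs_of_pos hc, pow_succ]
        calc c * _ ≤ 1 / 2 * ((1 / 2) ^ n * C) := by gcongr
          _ = _ := by ring
      by_cases ha : t ≤ (1 - α) / 2
      · refine step ((1 - α) / 2) 0 (by linarith) (by linarith) ⟨?_, ?_⟩ (letter (i + 1))
          fun x => by rw [sideCoord_fst]; ring
        · exact div_nonneg (by linarith [ht.1]) (by linarith)
        · rw [div_le_one (by linarith)]; linarith
      by_cases hb : t ≤ (1 + α) / 2
      · refine step α ((1 - α) / 2) h0 (by linarith) ⟨?_, ?_⟩ (Fin.natAdd 3 i)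
          fun x => by rw [sideCoord_mid]; ring
        · exact div_nonneg (by linarith) (by linarith)
        · rw [div_le_one (by linarith)]; linarith
      · refine step ((1 - α) / 2) ((1 + α) / 2) (by linarith) (by linarith) ⟨?_, ?_⟩
          (letter (i + 2)) fun x => by rw [sideCoord_snd]; ring
        · exact div_nonneg (by linarith) (by linarith)
        · rw [div_le_one (by linarith)]; linarith [ht.2]
  have : t ∈ closure (sideCoord i '' attractor hα) := by
    rw [Metric.mem_closure_iff]
    intro ε hε
    have hl : Tendsto (fun n : ℕ => (1 / 2 : ℝ) ^ n * (|sideCoord i x₀| + 1)) atTop (𝓝 0) := by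
      simpa using (tendsto_pow_atTop_nhds_zero_of_lt_one (r := (1 / 2 : ℝ)) (by norm_num)
        (by norm_num)).mul_const (|sideCoord i x₀| + 1)
    obtain ⟨n, hn⟩ := (hl.eventually (gt_mem_nhds hε)).exists
    obtain ⟨x, hx, hxt⟩ := happrox n t ht
    refine ⟨_, mem_image_of_mem _ hx, ?_⟩
    rw [Real.dist_eq, abs_sub_comm]
    exact hxt.trans_lt hn
  rw [hcl.closure_eq] at this
  exact this

theorem Vstar_subset : Vstar α ⊆ attractor hα := by
  intro x hx
  obtain ⟨n, hx | hx⟩ := mem_iUnion.1 hx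
  · obtain ⟨w, _, ⟨j, rfl⟩, rfl⟩ := mem_iUnion.1 hx
    exact wordMap_mem hα (point_mem hα _) w
  · simp only [J, mem_iUnion] at hx
    obtain ⟨m, -, w, y, hy, rfl⟩ := hx
    obtain ⟨i, hy⟩ := mem_iUnion.1 hy
    rw [openSegment_eq_image_lineMap] at hy
    obtain ⟨t, ht, rfl⟩ := hy
    obtain ⟨z, hz, rfl⟩ := exists_sideCoord_eq hα i (Ioo_subset_Icc_self ht)
    rw [AffineMap.lineMap_apply_module', ← contraction_side]
    exact wordMap_mem hα (contraction_mem hα hz _) w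

end Attractor

/-! ### The energies -/

/-- `u ∘ φ_e` for the segment `e = G_w(e_i)` of `V_n`, on `[0, 1]`; it is continued to `ℝ` by its
values at the end points. -/
def pullback {α : ℝ} {n : ℕ} (u : V α n → ℝ) {m : ℕ} (h : m < n) (w : Fin m → Fin 3) (i : Fin 3) :
    ℝ → ℝ :=
  IccExtend (zero_le_one (α := ℝ)) fun t => u ⟨path α w i t, path_mem_V α h w i t⟩

/-- The Sobolev space `H¹(0, 1)`, each class being represented by its continuous representative on
`[0, 1]`: the absolutely continuous functions with square integrable derivative. -/
def IsH1 (f : ℝ → ℝ) : Prop :=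
  AbsolutelyContinuousOnInterval f 0 1 ∧ MemLp (deriv f) 2 (volume.restrict (Ioo (0 : ℝ) 1))

/-- `D_n`. The segments of `V_n` are the `G_w(e_i)` with `w` of length less than `n`. -/
def levelDomain (α : ℝ) (n : ℕ) : Set (V α n → ℝ) :=
  {u | ∀ (m : ℕ) (h : m < n) (w : Fin m → Fin 3) (i : Fin 3), IsH1 (pullback u h w i)}

/-- `E_n^d[u]`: the sum of `(u(x) - u(y))²` over the unordered pairs of distinct `n`-neighbours,
i.e. over the sides of the triangles `G_w(p₁ p₂ p₃)` with `w` of length `n`; the side with index `i`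
is the one opposite to the `i`-th vertex. -/
def discreteEnergy {α : ℝ} {n : ℕ} (u : V α n → ℝ) : ℝ :=
  ∑ w : Fin n → Fin 3, ∑ i : Fin 3,
    (u ⟨wordMap α w (point (letter (i + 1))), wordMap_point_mem_V α w _⟩ -
      u ⟨wordMap α w (point (letter (i + 2))), wordMap_point_mem_V α w _⟩) ^ 2

/-- `E^c_{k⁻}[u]` with `k = m + 1`: the sum of `∫₀¹ |(u ∘ φ_e)'|² dt` over the segments `e` of
`J_{m+1}` that are not in `J_m`. -/
def segmentEnergy {α : ℝ} {n : ℕ} (u : V α n → ℝ) {m : ℕ} (h : m < n) : ℝ :=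
  ∑ w : Fin m → Fin 3, ∑ i : Fin 3, ∫ t in (0 : ℝ)..1, deriv (pullback u h w i) t ^ 2

/-- `d_k = α ((1 - α) / 2) ^ (k - 1)` for `k = m + 1`, the length of the segments of level `k`. -/
def segLength (α : ℝ) (m : ℕ) : ℝ := α * ((1 - α) / 2) ^ m

/-- `ρ_n^d = ∏_{k=1}^n r_k^d`, with `r_k^d = 3 / (5 + 3 d_k)`. -/
def rhoDiscrete (α : ℝ) (n : ℕ) : ℝ := ∏ m ∈ Finset.range n, 3 / (5 + 3 * segLength α m)

/-- `ρ_k^c = ρ_{k-1}^d r_k^c` for `k = m + 1`, with `r_k^c = 3 d_k / (5 + 3 d_k)`. -/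
def rhoSegment (α : ℝ) (m : ℕ) : ℝ :=
  rhoDiscrete α m * (3 * segLength α m / (5 + 3 * segLength α m))

/-- The renormalized energy `ℰ_n[u] = E_n^d[u] / ρ_n^d + ∑_{k=1}^n E^c_{k⁻}[u] / ρ_k^c`. -/
def levelEnergy {α : ℝ} {n : ℕ} (u : V α n → ℝ) : ℝ :=
  (rhoDiscrete α n)⁻¹ * discreteEnergy u +
    ∑ m : Fin n, (rhoSegment α m)⁻¹ * segmentEnergy u m.isLt

/-- Restriction of a function on `V_*` to `V_n`. -/
def restrictLevel {α : ℝ} (u : Vstar α → ℝ) (n : ℕ) : V α n → ℝ :=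
  fun x => u ⟨x, mem_iUnion_of_mem n x.2⟩

/-- `D_*`: the functions on `V_*` of finite limiting energy. -/
def starDomain (α : ℝ) : Set (Vstar α → ℝ) :=
  {u | (∀ n, restrictLevel u n ∈ levelDomain α n) ∧
    ∃ L : ℝ, Tendsto (fun n => levelEnergy (restrictLevel u n)) atTop (𝓝 L)}

def starEnergy {α : ℝ} (u : Vstar α → ℝ) : ℝ :=
  limUnder atTop fun n => levelEnergy (restrictLevel u n)

section Form

variable {α : ℝ} (hα : α ∈ Ioo (0 : ℝ) (1 / 3))

/-- Restriction of a function on `K_α` to `V_*`. -/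
def restrictStar (u : attractor hα → ℝ) : Vstar α → ℝ := fun x => u ⟨x, Vstar_subset hα x.2⟩

/-- `ℱ`: the functions of `D_*`, extended by continuity to `K_α`. -/
def domain : Set (attractor hα → ℝ) := {u | Continuous u ∧ restrictStar hα u ∈ starDomain α}

/-- `ℰ[u] = lim ℰ_n[u|_{V_n}]`. -/
def energy (u : attractor hα → ℝ) : ℝ := starEnergy (restrictStar hα u)

/-- The bilinear form `ℰ(u, v)` obtained from `ℰ[u]` by polarization. -/
def form (u v : attractor hα → ℝ) : ℝ :=
  1 / 2 * (energy hα (u + v) - energy hα u - energy hα v)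

end Form

end Hanoi

end

/-! The theorem rests on three facts.

Monotonicity. Passing from level n to n + 1 replaces each triangle by three small triangles joined
by three segments. Relative to unit resistances on the large triangle, give the small edges
resistance r and the segments resistance r d. Star-triangle transformations turn the new network
into a star with arms r/3 + r(2/3 + d)/3 = r(5 + 3d)/9, which is equivalent to the large triangle
exactly when r = 3/(5 + 3d). With this scaling, refinement can only raise the energy
(`triangle_energy_le`, `levelForm_monotone`), so the limit is a supremum and finite energy means
bounded level energies.

Oscillation. Since ρ_n ≤ (3/5)^n, chaining through vertices of nested cells bounds the squared
oscillation of u on a cell of level n by 100 ρ_n ℰ[u] (`abs_sub_vertex_le`,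
`sq_sub_le_of_mem_cell`); along a segment u is 1/2-Hölder by Cauchy–Schwarz. At level 0 this bounds
all resistances and makes energy-Cauchy sequences, normalised at a point, converge uniformly, whence
completeness. At high levels it shows that points close in the plane are close in resistance
(`eventually_sq_sub_le`).

Supply of functions. Cells of equal level are disjoint and compact, so points are separated by
Lipschitz functions constant on the cells of some level, whose energy sits on finitely many segments
(`exists_lipschitz_separating`, `lipschitz_mem_domain`). With compactness they bound resistances
from below. The Markov property holds term by term and makes the domain a lattice, so the lattice
form of Stone–Weierstrass gives regularity. -/

namespace Hanoi

/-! ### The Sobolev space on the unit interval -/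

/-- The Dirichlet form `∫₀¹ f' g'`. -/
noncomputable def dirichlet (f g : ℝ → ℝ) : ℝ := ∫ t in Ioo (0 : ℝ) 1, deriv f t * deriv g t

theorem dirichlet_self (f : ℝ → ℝ) : dirichlet f f = ∫ t in (0 : ℝ)..1, deriv f t ^ 2 := by
  rw [intervalIntegral.integral_of_le zero_le_one, integral_Ioc_eq_integral_Ioo]
  simp only [dirichlet, sq]

theorem dirichlet_nonneg (f : ℝ → ℝ) : 0 ≤ dirichlet f f :=
  integral_nonneg fun _ => mul_self_nonneg _

theorem dirichlet_comm (f g : ℝ → ℝ) : dirichlet f g = dirichlet g f := by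
  simp only [dirichlet, mul_comm]

theorem dirichlet_const (c : ℝ) (g : ℝ → ℝ) : dirichlet (fun _ => c) g = 0 := by
  simp [dirichlet]

namespace IsH1

variable {f g : ℝ → ℝ}

theorem ae_differentiableAt (hf : IsH1 f) :
    ∀ᵐ t ∂volume.restrict (Ioo (0 : ℝ) 1), DifferentiableAt ℝ f t := by
  rw [ae_restrict_iff' measurableSet_Ioo]
  filter_upwards [hf.1.ae_differentiableAt] with t ht h
  refine ht ?_
  rw [uIcc_of_le zero_le_one]
  exact Ioo_subset_Icc_self h

theorem deriv_add (hf : IsH1 f) (hg : IsH1 g) :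
    deriv (f + g) =ᵐ[volume.restrict (Ioo (0 : ℝ) 1)] deriv f + deriv g := by
  filter_upwards [hf.ae_differentiableAt, hg.ae_differentiableAt] with t h1 h2
  exact _root_.deriv_add h1 h2

theorem deriv_sub (hf : IsH1 f) (hg : IsH1 g) :
    deriv (f - g) =ᵐ[volume.restrict (Ioo (0 : ℝ) 1)] deriv f - deriv g := by
  filter_upwards [hf.ae_differentiableAt, hg.ae_differentiableAt] with t h1 h2
  exact _root_.deriv_sub h1 h2

theorem add (hf : IsH1 f) (hg : IsH1 g) : IsH1 (f + g) :=
  ⟨hf.1.add hg.1, (memLp_congr_ae (hf.deriv_add hg)).2 (hf.2.add hg.2)⟩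

theorem sub (hf : IsH1 f) (hg : IsH1 g) : IsH1 (f - g) :=
  ⟨hf.1.sub hg.1, (memLp_congr_ae (hf.deriv_sub hg)).2 (hf.2.sub hg.2)⟩

theorem const_smul (c : ℝ) (hf : IsH1 f) : IsH1 (c • f) := by
  refine ⟨hf.1.const_smul c, ?_⟩
  have : deriv (c • f) = c • deriv f := by ext t; exact deriv_const_smul_field c f
  rw [this]
  exact hf.2.const_smul c

theorem of_lipschitz {C : NNReal} (hf : LipschitzWith C f) : IsH1 f := by
  refine ⟨(hf.lipschitzOnWith (s := _)).absolutelyContinuousOnInterval, ?_⟩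
  exact MemLp.of_bound (measurable_deriv f).aestronglyMeasurable C
    (Eventually.of_forall fun t => norm_deriv_le_of_lipschitz hf)

theorem const (c : ℝ) : IsH1 fun _ => c := of_lipschitz (LipschitzWith.const c)

theorem integrable_deriv_mul (hf : IsH1 f) (hg : IsH1 g) :
    Integrable (fun t => deriv f t * deriv g t) (volume.restrict (Ioo (0 : ℝ) 1)) :=
  hf.2.integrable_mul hg.2

theorem dirichlet_add_left (hf : IsH1 f) (hg : IsH1 g) {h : ℝ → ℝ} (hh : IsH1 h) :
    dirichlet (f + g) h = dirichlet f h + dirichlet g h := by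
  rw [dirichlet, dirichlet, dirichlet,
    ← integral_add (hf.integrable_deriv_mul hh) (hg.integrable_deriv_mul hh)]
  refine integral_congr_ae ?_
  filter_upwards [hf.deriv_add hg] with t ht
  rw [ht, Pi.add_apply, add_mul]

/-- Difference quotients of `φ ∘ f` are dominated by those of `f`, hence so is the derivative
wherever both exist; where `φ ∘ f` is not differentiable its `deriv` is 0. -/
theorem comp_lipschitz (hf : IsH1 f) {φ : ℝ → ℝ} (hφ : LipschitzWith 1 φ) :
    IsH1 (φ ∘ f) ∧ dirichlet (φ ∘ f) (φ ∘ f) ≤ dirichlet f f := by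
  have hd : ∀ᵐ t ∂volume.restrict (Ioo (0 : ℝ) 1), ‖deriv (φ ∘ f) t‖ ≤ ‖deriv f t‖ := by
    filter_upwards [hf.ae_differentiableAt] with t ht
    by_cases h : DifferentiableAt ℝ (φ ∘ f) t
    · have h1 := (hasDerivAt_iff_tendsto_slope.1 h.hasDerivAt).norm
      have h2 := (hasDerivAt_iff_tendsto_slope.1 ht.hasDerivAt).norm
      refine le_of_tendsto_of_tendsto h1 h2 (Eventually.of_forall fun s => ?_)
      simp only [slope, vsub_eq_sub, norm_smul]
      gcongr
      simpa using hφ.norm_sub_le (f s) (f t)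
    · rw [deriv_zero_of_not_differentiableAt h]
      simp
  have hm : MemLp (deriv (φ ∘ f)) 2 (volume.restrict (Ioo (0 : ℝ) 1)) :=
    hf.2.of_le (measurable_deriv _).aestronglyMeasurable hd
  have ha : AbsolutelyContinuousOnInterval (φ ∘ f) 0 1 := by
    -- Absolute continuity is a limit statement about sums of increments, and those of `φ ∘ f` are
    -- termwise smaller.
    refine squeeze_zero (fun E => Finset.sum_nonneg fun i _ => dist_nonneg)
      (fun E => Finset.sum_le_sum fun i _ => ?_) hf.1
    simpa using hφ.dist_le_mul (f (E.2 i).1) (f (E.2 i).2)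
  refine ⟨⟨ha, hm⟩, ?_⟩
  refine integral_mono_ae (hm.integrable_mul hm) (hf.integrable_deriv_mul hf) ?_
  filter_upwards [hd] with t ht
  have := mul_self_le_mul_self (norm_nonneg _) ht
  simpa [← sq] using this

end IsH1

theorem dirichlet_smul_left (c : ℝ) (f g : ℝ → ℝ) :
    dirichlet (c • f) g = c * dirichlet f g := by
  have : deriv (c • f) = c • deriv f := by ext t; exact deriv_const_smul_field c f
  rw [dirichlet, dirichlet, this, ← integral_const_mul]
  simp [mul_assoc]

/-- The Cauchy–Schwarz inequality for an integral over a part of the unit interval. -/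
theorem sq_intervalIntegral_le {g : ℝ → ℝ} (hg : MemLp g 2 (volume.restrict (Ioo (0 : ℝ) 1)))
    {s t : ℝ} (hs : 0 ≤ s) (hst : s ≤ t) (ht : t ≤ 1) :
    (∫ x in s..t, g x) ^ 2 ≤ (t - s) * ∫ x in Ioo (0 : ℝ) 1, g x * g x := by
  have hsub : Ioo s t ⊆ Ioo (0 : ℝ) 1 := Ioo_subset_Ioo hs ht
  have hg' : MemLp g 2 (volume.restrict (Ioo s t)) :=
    hg.mono_measure (Measure.restrict_mono hsub le_rfl)
  have h2 : Integrable (fun x => g x * g x) (volume.restrict (Ioo s t)) := hg'.integrable_mul hg'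
  have h1 : Integrable g (volume.restrict (Ioo s t)) := hg'.integrable one_le_two
  have hle : ∫ x in Ioo s t, g x * g x ≤ ∫ x in Ioo (0 : ℝ) 1, g x * g x :=
    setIntegral_mono_set (hg.integrable_mul hg)
      (Eventually.of_forall fun x => mul_self_nonneg _) hsub.eventuallyLE
  rw [intervalIntegral.integral_of_le hst, integral_Ioc_eq_integral_Ioo]
  rcases hst.eq_or_lt with rfl | hst
  · simp
  -- With c the integral of g, integrating the square of (t - s) g - c gives (t - s)((t - s) ∫ g² -
  -- c²) ≥ 0.
  set c := ∫ x in Ioo s t, g x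
  have hpos : 0 ≤ ∫ x in Ioo s t, ((t - s) * g x - c) * ((t - s) * g x - c) :=
    integral_nonneg fun _ => mul_self_nonneg _
  have hexp : ∫ x in Ioo s t, ((t - s) * g x - c) * ((t - s) * g x - c) =
      (t - s) ^ 2 * (∫ x in Ioo s t, g x * g x) - 2 * (t - s) * c * c + c ^ 2 * (t - s) := by
    have : ∀ x, ((t - s) * g x - c) * ((t - s) * g x - c) =
        (t - s) ^ 2 * (g x * g x) - 2 * (t - s) * c * g x + c ^ 2 := fun x => by ring
    simp_rw [this]
    have e1 := integral_add ((h2.const_mul ((t - s) ^ 2)).sub (h1.const_mul (2 * (t - s) * c)))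
      (integrable_const (c ^ 2))
    simp only [Pi.sub_apply] at e1
    rw [e1, integral_sub (h2.const_mul _) (h1.const_mul _), integral_const_mul,
      integral_const_mul]
    simp [hst.le]
    ring
  rw [hexp] at hpos
  have hts : 0 < t - s := sub_pos.2 hst
  have : 0 ≤ (t - s) * ((t - s) * (∫ x in Ioo s t, g x * g x) - c ^ 2) := by linarith
  have := nonneg_of_mul_nonneg_right this hts
  nlinarith

/-- The fundamental theorem of calculus followed by Cauchy–Schwarz; every estimate along a segment
comes from here. -/
theorem IsH1.sq_sub_le {f : ℝ → ℝ} (hf : IsH1 f) {s t : ℝ} (hs : s ∈ Icc (0 : ℝ) 1)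
    (ht : t ∈ Icc (0 : ℝ) 1) : (f t - f s) ^ 2 ≤ |t - s| * dirichlet f f := by
  wlog h : s ≤ t generalizing s t
  · have := this ht hs (le_of_not_ge h)
    rwa [abs_sub_comm, ← neg_sub, neg_sq] at this
  have hac : AbsolutelyContinuousOnInterval f s t := hf.1.mono (by
    rw [uIcc_of_le h, uIcc_of_le zero_le_one]
    exact Icc_subset_Icc hs.1 ht.2)
  rw [← hac.integral_deriv_eq_sub, abs_of_nonneg (sub_nonneg.2 h)]
  exact sq_intervalIntegral_le hf.2 hs.1 h ht.2

theorem MemLp.norm_toLp_mul_self {g : ℝ → ℝ} {μ : Measure ℝ} (hg : MemLp g 2 μ) :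
    ‖hg.toLp g‖ ^ 2 = ∫ x, g x * g x ∂μ := by
  rw [← real_inner_self_eq_norm_sq (hg.toLp g), L2.inner_def]
  refine integral_congr_ae ?_
  filter_upwards [hg.coeFn_toLp] with x hx
  simp [hx, sq]

/-- A sequence in `H¹` that is Cauchy for the Dirichlet form and converges pointwise converges
in `H¹`. -/
theorem IsH1.of_tendsto {f : ℕ → ℝ → ℝ} (hf : ∀ n, IsH1 (f n)) {F : ℝ → ℝ}
    (hF : ∀ t ∈ Icc (0 : ℝ) 1, Tendsto (fun n => f n t) atTop (𝓝 (F t)))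
    (hc : ∀ ε > 0, ∃ N, ∀ m ≥ N, ∀ n ≥ N, dirichlet (f m - f n) (f m - f n) < ε) :
    IsH1 F ∧ Tendsto (fun n => dirichlet (f n - F) (f n - F)) atTop (𝓝 0) := by
  set μ := volume.restrict (Ioo (0 : ℝ) 1)
  have hdist : ∀ m n, ‖(hf m).2.toLp (deriv (f m)) - (hf n).2.toLp (deriv (f n))‖ ^ 2 =
      dirichlet (f m - f n) (f m - f n) := by
    intro m n
    rw [← MemLp.toLp_sub, MemLp.norm_toLp_mul_self]
    refine integral_congr_ae ?_
    filter_upwards [(hf m).deriv_sub (hf n)] with x hx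
    rw [hx]
  have hcau : CauchySeq fun n => (hf n).2.toLp (deriv (f n)) := by
    rw [Metric.cauchySeq_iff]
    intro ε hε
    obtain ⟨N, hN⟩ := hc (ε ^ 2) (by positivity)
    refine ⟨N, fun m hm n hn => ?_⟩
    rw [dist_eq_norm]
    have := hN m hm n hn
    rw [← hdist] at this
    exact lt_of_pow_lt_pow_left₀ 2 hε.le this
  -- The derivatives converge in L²; what remains is to recognise `F` as a primitive of the limit.
  obtain ⟨G, hG⟩ := cauchySeq_tendsto_of_complete hcau
  obtain ⟨g, hg, rfl⟩ : ∃ g, ∃ hg : MemLp g 2 μ, hg.toLp g = G :=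
    ⟨G, Lp.memLp G, Lp.toLp_coeFn G _⟩
  have hlim : Tendsto (fun n => ∫ x in Ioo (0 : ℝ) 1,
      (deriv (f n) - g) x * (deriv (f n) - g) x) atTop (𝓝 0) := by
    have := (tendsto_iff_norm_sub_tendsto_zero.1 hG).pow 2
    rw [zero_pow two_ne_zero] at this
    refine this.congr fun n => ?_
    rw [← MemLp.toLp_sub, MemLp.norm_toLp_mul_self]
  have hgi : IntervalIntegrable g volume 0 1 := by
    rw [intervalIntegrable_iff_integrableOn_Ioo_of_le zero_le_one]
    exact hg.integrable one_le_two
  have hint : ∀ t ∈ Icc (0 : ℝ) 1, F t = F 0 + ∫ x in (0 : ℝ)..t, g x := by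
    intro t ht
    have hsub : uIcc (0 : ℝ) t ⊆ uIcc 0 1 := by
      rw [uIcc_of_le ht.1, uIcc_of_le zero_le_one]
      exact Icc_subset_Icc_right ht.2
    have h1 : Tendsto (fun n => ∫ x in (0 : ℝ)..t, (deriv (f n) - g) x) atTop (𝓝 0) := by
      have hsq := hlim.sqrt
      rw [Real.sqrt_zero] at hsq
      refine squeeze_zero_norm (fun n => Real.abs_le_sqrt ?_) hsq
      refine (sq_intervalIntegral_le ((hf n).2.sub hg) le_rfl ht.1 ht.2).trans ?_
      have h0 : 0 ≤ ∫ x in Ioo (0 : ℝ) 1, (deriv (f n) - g) x * (deriv (f n) - g) x :=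
        integral_nonneg fun _ => mul_self_nonneg _
      nlinarith [ht.2]
    have h2 : ∀ n, ∫ x in (0 : ℝ)..t, (deriv (f n) - g) x =
        f n t - f n 0 - ∫ x in (0 : ℝ)..t, g x := by
      intro n
      have hac := (hf n).1.mono hsub
      rw [← hac.integral_deriv_eq_sub,
        ← intervalIntegral.integral_sub hac.intervalIntegrable_deriv (hgi.mono_set hsub)]
      rfl
    simp_rw [h2] at h1
    have h3 := ((hF t ht).sub (hF 0 (by simp))).sub_const (∫ x in (0 : ℝ)..t, g x)
    have := tendsto_nhds_unique h1 h3
    linarith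
  have hac : AbsolutelyContinuousOnInterval F 0 1 := by
    have h1 := hgi.absolutelyContinuousOnInterval_intervalIntegral (c := 0) (by simp)
    have h2 : AbsolutelyContinuousOnInterval (fun _ : ℝ => F 0) 0 1 := (IsH1.const (F 0)).1
    have h3 := h2.add h1
    -- `F` is known to be a primitive only on [0, 1], which is all that absolute continuity there
    -- sees.
    refine h3.congr' ?_
    refine eventually_inf_principal.2 (Eventually.of_forall fun E hE => ?_)
    refine Finset.sum_congr rfl fun i hi => ?_
    have := hE.1 i hi
    rw [uIcc_of_le zero_le_one] at this
    rw [hint _ this.1, hint _ this.2]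
    rfl
  have hderiv : deriv F =ᵐ[μ] g := by
    rw [Filter.EventuallyEq, ae_restrict_iff' measurableSet_Ioo]
    filter_upwards [hgi.ae_hasDerivAt_integral] with t ht h
    have h' : t ∈ uIcc (0 : ℝ) 1 := by
      rw [uIcc_of_le zero_le_one]
      exact Ioo_subset_Icc_self h
    have h1 := (ht h' 0 (by simp)).const_add (F 0)
    refine (h1.congr_of_eventuallyEq ?_).deriv
    filter_upwards [isOpen_Ioo.mem_nhds h] with s hs
    exact hint s (Ioo_subset_Icc_self hs)
  have hFH : IsH1 F := ⟨hac, (memLp_congr_ae hderiv).2 hg⟩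
  refine ⟨hFH, hlim.congr fun n => integral_congr_ae ?_⟩
  filter_upwards [(hf n).deriv_sub hFH, hderiv] with x h1 h2
  rw [h1, Pi.sub_apply, Pi.sub_apply, h2]

/-! ### Cells of the attractor -/

/-- `wordMap` unfolds from the outermost letter, whereas passing to a subcell appends an innermost
one. -/
theorem wordMap_snoc (α : ℝ) (j : Fin 3) (x : Plane) {n : ℕ} (w : Fin n → Fin 3) :
    wordMap α (Fin.snoc w j : Fin (n + 1) → Fin 3) x = wordMap α w (contraction α (letter j) x) := by
  induction n with
  | zero => rfl
  | succ n ih =>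
    have h : (Fin.snoc w j : Fin (n + 2) → Fin 3) =
        Fin.cons (w 0) (Fin.snoc (Fin.tail w) j : Fin (n + 1) → Fin 3) := by
      rw [Fin.cons_snoc_eq_snoc_cons, Fin.cons_self_tail]
    rw [h]
    change contraction α (letter (w 0)) (wordMap α (Fin.snoc (Fin.tail w) j : Fin (n + 1) → _) x) =
      contraction α (letter (w 0)) (wordMap α (Fin.tail w) _)
    rw [ih]

theorem wordMap_snoc_point (α : ℝ) {n : ℕ} (w : Fin n → Fin 3) (j : Fin 3) :
    wordMap α (Fin.snoc w j : Fin (n + 1) → Fin 3) (point (letter j)) =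
      wordMap α w (point (letter j)) := by
  rw [wordMap_snoc, contraction_point]

theorem path_zero (α : ℝ) {m : ℕ} (w : Fin m → Fin 3) (i : Fin 3) :
    path α w i 0 =
      wordMap α (Fin.snoc w (i + 1) : Fin (m + 1) → Fin 3) (point (letter (i + 2))) := by
  rw [wordMap_snoc, path, zero_smul, zero_add, segStart]

theorem path_one (α : ℝ) {m : ℕ} (w : Fin m → Fin 3) (i : Fin 3) :
    path α w i 1 =
      wordMap α (Fin.snoc w (i + 2) : Fin (m + 1) → Fin 3) (point (letter (i + 1))) := by
  rw [wordMap_snoc, path, one_smul, sub_add_cancel, segEnd]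

theorem path_sub (α : ℝ) {m : ℕ} (w : Fin m → Fin 3) (i : Fin 3) (s t : ℝ) :
    path α w i s - path α w i t =
      (s - t) • (wordMap α w (segEnd α i) - wordMap α w (segStart α i)) := by
  simp only [path]
  module

/-! ### The contractions in side coordinates -/

theorem sideCoord_apex (α : ℝ) (i : Fin 3) (x : Plane) :
    sideCoord i (contraction α (letter i) x) = 1 / 2 + (1 - α) / 2 * (sideCoord i x - 1 / 2) := by
  have h4 : √3 ^ 2 = 3 := Real.sq_sqrt (by norm_num)
  fin_cases i <;>
    simp [sideCoord, contraction, point, linearPart, letter, Matrix.toEuclideanLin] <;>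
    grind

/-- The cyclically oriented sides meet at angles of 120°, so the projection onto another side
contributes the factor α cos 120° = -α/2; the midpoints of the other two sides have coordinates 3/4
and 1/4. -/
theorem sideCoord_mid_succ (α : ℝ) (i : Fin 3) (x : Plane) :
    sideCoord i (contraction α (Fin.natAdd 3 (i + 1)) x) =
      3 / 4 - α / 2 * (sideCoord (i + 1) x - 1 / 2) := by
  have h4 : √3 ^ 2 = 3 := Real.sq_sqrt (by norm_num)
  fin_cases i <;>
    simp [sideCoord, contraction, point, linearPart, Matrix.vecHead, Matrix.vecTail,
      Matrix.toEuclideanLin, Matrix.toLpLin_apply] <;>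
    grind

theorem sideCoord_mid_succ_succ (α : ℝ) (i : Fin 3) (x : Plane) :
    sideCoord i (contraction α (Fin.natAdd 3 (i + 2)) x) =
      1 / 4 - α / 2 * (sideCoord (i + 2) x - 1 / 2) := by
  have h4 : √3 ^ 2 = 3 := Real.sq_sqrt (by norm_num)
  fin_cases i <;>
    simp [sideCoord, contraction, point, linearPart, Matrix.vecHead, Matrix.vecTail,
      Matrix.toEuclideanLin, Matrix.toLpLin_apply] <;>
    grind

theorem continuous_sideCoord (i : Fin 3) : Continuous (sideCoord i) := by
  fin_cases i
  · change Continuous fun x : Plane => ((x 0 - 1 / 2) - √3 * (x 1 - √3 / 2)) / 2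
    fun_prop
  · change Continuous fun x : Plane => 1 - x 0
    fun_prop
  · change Continuous fun x : Plane => (x 0 + √3 * x 1) / 2
    fun_prop

theorem contraction_letter_injective {α : ℝ} (hα : α ∈ Ioo (0 : ℝ) (1 / 3)) (j : Fin 3) :
    Function.Injective (contraction α (letter j)) := by
  have h : ∀ x, contraction α (letter j) x =
      ((1 - α) / 2) • (x - point (letter j)) + point (letter j) := by
    intro x
    have : linearPart α (letter j) = ((1 - α) / 2) • 1 := by fin_cases j <;> rfl
    rw [contraction, this]
    congr 1
    ext k
    simp [Matrix.toEuclideanLin]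
  intro x y hxy
  rw [h, h, add_left_inj] at hxy
  have h0 : (1 - α) / 2 ≠ 0 := by linarith [hα.2]
  exact sub_left_injective (smul_right_injective _ h0 hxy)

theorem continuous_wordMap {α : ℝ} (hα : α ∈ Ioo (0 : ℝ) (1 / 3)) {n : ℕ} (w : Fin n → Fin 3) :
    Continuous (wordMap α w) := by
  induction n with
  | zero => exact continuous_id
  | succ n ih => exact (contraction_lipschitz hα _).continuous.comp (ih _)

theorem dist_wordMap_le {α : ℝ} (hα : α ∈ Ioo (0 : ℝ) (1 / 3)) {n : ℕ} (w : Fin n → Fin 3)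
    (x y : Plane) :
    dist (wordMap α w x) (wordMap α w y) ≤ (1 / 2) ^ n * dist x y := by
  induction n with
  | zero => simp [wordMap]
  | succ n ih =>
    have h1 := (contraction_lipschitz hα (letter (w 0))).dist_le_mul
      (wordMap α (Fin.tail w) x) (wordMap α (Fin.tail w) y)
    have h2 := ih (Fin.tail w)
    simp only [NNReal.coe_div, NNReal.coe_one, NNReal.coe_ofNat] at h1
    simp only [wordMap, Function.comp_apply]
    rw [pow_succ]
    linarith

section Attractor

variable {α : ℝ} (hα : α ∈ Ioo (0 : ℝ) (1 / 3))

theorem exists_contraction_eq {x : Plane} (hx : x ∈ attractor hα) :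
    ∃ y ∈ attractor hα, (∃ j : Fin 3, x = contraction α (letter j) y) ∨
      ∃ j : Fin 3, x = contraction α (Fin.natAdd 3 j) y := by
  rw [attractor_eq hα] at hx
  obtain ⟨k, y, hy, rfl⟩ := mem_iUnion.1 hx
  refine ⟨y, hy, ?_⟩
  induction k using Fin.addCases (m := 3) (n := 3) with
  | left j => exact Or.inl ⟨j, rfl⟩
  | right j => exact Or.inr ⟨j, rfl⟩

/-- A maximum principle: let M be the maximum over the attractor of all three deviations from 1/2.
They are treated together because the segment maps express one coordinate through another. A
maximiser is the image of a point whose deviations are at most M, and the affine formulas forbid M >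
1/2. -/
theorem abs_sideCoord_sub_half_le (i : Fin 3) {x : Plane} (hx : x ∈ attractor hα) :
    |sideCoord i x - 1 / 2| ≤ 1 / 2 := by
  have h0 := hα.1
  have h1 := hα.2
  let h : Plane → ℝ := fun x => Finset.univ.sup' Finset.univ_nonempty
    fun i : Fin 3 => |sideCoord i x - 1 / 2|
  have hc : Continuous h := Continuous.finset_sup'_apply _ fun i _ =>
    ((continuous_sideCoord i).sub continuous_const).abs
  have hle : ∀ (i : Fin 3) (x : Plane), |sideCoord i x - 1 / 2| ≤ h x := fun i x =>
    Finset.le_sup' (fun i : Fin 3 => |sideCoord i x - 1 / 2|) (Finset.mem_univ i)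
  obtain ⟨z, hz, hmax⟩ := (attractor_isCompact hα).exists_isMaxOn (attractor_nonempty hα)
    hc.continuousOn
  refine (hle i x).trans ((hmax hx).trans ?_)
  by_contra! hM
  obtain ⟨i, -, hi⟩ := Finset.exists_mem_eq_sup' Finset.univ_nonempty
    fun i : Fin 3 => |sideCoord i z - 1 / 2|
  change h z = |sideCoord i z - 1 / 2| at hi
  obtain ⟨y, hy, hzy⟩ := exists_contraction_eq hα hz
  have hb : ∀ k, |sideCoord k y - 1 / 2| ≤ h z := fun k => (hle k y).trans (hmax hy)
  generalize h z = M at *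
  -- If M > 1/2, then |a| + |b| M ≤ 1/2 + |b| (M - 1/2) < M.
  have key : ∀ (k : Fin 3) (s a b : ℝ), s = 1 / 2 + a + b * (sideCoord k y - 1 / 2) →
      |b| < 1 → |a| + |b| / 2 ≤ 1 / 2 → |s - 1 / 2| < M := by
    rintro k s a b rfl hb1 hab
    rw [show 1 / 2 + a + b * (sideCoord k y - 1 / 2) - 1 / 2 =
      a + b * (sideCoord k y - 1 / 2) by ring]
    have e1 := abs_add_le a (b * (sideCoord k y - 1 / 2))
    rw [abs_mul] at e1
    have e2 := mul_le_mul_of_nonneg_left (hb k) (abs_nonneg b)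
    nlinarith
  have hcases : ∀ i j : Fin 3, j = i ∨ j = i + 1 ∨ j = i + 2 := by decide
  have hA : |(1 - α) / 2| = (1 - α) / 2 := abs_of_pos (by linarith)
  have hB : |-(α / 2)| = α / 2 := by rw [abs_neg, abs_of_pos (by linarith)]
  have hC : |(1 + α) / 4| = (1 + α) / 4 := abs_of_pos (by linarith)
  have hD : |(1 / 4 : ℝ)| = 1 / 4 := abs_of_pos (by norm_num)
  have hE : |α| = α := abs_of_pos h0
  refine absurd hi (ne_of_gt ?_)
  rcases hzy with ⟨j, rfl⟩ | ⟨j, rfl⟩ <;> rcases hcases i j with rfl | rfl | rfl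
  · refine key j _ 0 ((1 - α) / 2) ((sideCoord_apex _ _ _).trans (by ring)) ?_ ?_
    · rw [hA]; linarith
    · rw [hA, abs_zero]; linarith
  · refine key i _ (-((1 + α) / 4)) ((1 - α) / 2) ((sideCoord_fst _ _ _).trans (by ring)) ?_ ?_
    · rw [hA]; linarith
    · rw [hA, abs_neg, hC]; linarith
  · refine key i _ ((1 + α) / 4) ((1 - α) / 2) ((sideCoord_snd _ _ _).trans (by ring)) ?_ ?_
    · rw [hA]; linarith
    · rw [hA, hC]; linarith
  · refine key j _ 0 α ((sideCoord_mid _ _ _).trans (by ring)) ?_ ?_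
    · rw [hE]; linarith
    · rw [hE, abs_zero]; linarith
  · refine key (i + 1) _ (1 / 4) (-(α / 2)) ((sideCoord_mid_succ _ _ _).trans (by ring)) ?_ ?_
    · rw [hB]; linarith
    · rw [hB, hD]; linarith
  · refine key (i + 2) _ (-(1 / 4)) (-(α / 2))
      ((sideCoord_mid_succ_succ _ _ _).trans (by ring)) ?_ ?_
    · rw [hB]; linarith
    · rw [hB, abs_neg, hD]; linarith

theorem sideCoord_mem_Icc (i : Fin 3) {x : Plane} (hx : x ∈ attractor hα) :
    sideCoord i x ∈ Icc (0 : ℝ) 1 := by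
  have := abs_le.1 (abs_sideCoord_sub_half_le hα i hx)
  constructor <;> linarith [this.1, this.2]

/-- The cell `G_w(K_α)`. -/
def cell {n : ℕ} (w : Fin n → Fin 3) : Set Plane := wordMap α w '' attractor hα

theorem isCompact_cell {n : ℕ} (w : Fin n → Fin 3) : IsCompact (cell hα w) :=
  (attractor_isCompact hα).image (continuous_wordMap hα w)

/-- The cells of level `n` become uniformly small. -/
theorem exists_dist_lt_of_mem_cell {ε : ℝ} (hε : 0 < ε) :
    ∃ N, ∀ n ≥ N, ∀ (w : Fin n → Fin 3), ∀ x ∈ cell hα w, ∀ y ∈ cell hα w, dist x y < ε := by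
  set D := diam (attractor hα)
  have hl : Tendsto (fun n : ℕ => (1 / 2 : ℝ) ^ n * D) atTop (𝓝 0) := by
    simpa using (tendsto_pow_atTop_nhds_zero_of_lt_one (r := (1 / 2 : ℝ)) (by norm_num)
      (by norm_num)).mul_const D
  obtain ⟨N, hN⟩ := eventually_atTop.1 (hl.eventually (gt_mem_nhds hε))
  refine ⟨N, fun n hn w => ?_⟩
  rintro _ ⟨x, hx, rfl⟩ _ ⟨y, hy, rfl⟩
  refine ((dist_wordMap_le hα w x y).trans ?_).trans_lt (hN n hn)
  gcongr
  exact dist_le_diam_of_mem (attractor_isCompact hα).isBounded hx hy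

/-- Subcells with different letters are separated in a side coordinate by the gap from (1 - α)/2 to
(1 + α)/2; a common prefix is removed by injectivity. -/
theorem disjoint_cell {n : ℕ} {w w' : Fin n → Fin 3} (h : w ≠ w') :
    Disjoint (cell hα w) (cell hα w') := by
  have base : ∀ i : Fin 3, ∀ x ∈ attractor hα, ∀ y ∈ attractor hα,
      contraction α (letter (i + 1)) x ≠ contraction α (letter (i + 2)) y := by
    intro i x hx y hy hxy
    have e := congrArg (sideCoord i) hxy
    rw [sideCoord_fst, sideCoord_snd] at e
    have h1 := (sideCoord_mem_Icc hα i hx).2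
    have h2 := (sideCoord_mem_Icc hα i hy).1
    have h3 := hα.1
    have h4 := hα.2
    nlinarith
  rw [disjoint_left]
  rintro _ ⟨x, hx, rfl⟩ ⟨y, hy, hxy⟩
  induction n with
  | zero => exact h (Subsingleton.elim _ _)
  | succ n ih =>
    simp only [wordMap, Function.comp_apply] at hxy
    by_cases h0 : w 0 = w' 0
    · have ht : Fin.tail w ≠ Fin.tail w' := by
        intro ht
        rw [← Fin.cons_self_tail w, ← Fin.cons_self_tail w', h0, ht] at h
        exact h rfl
      rw [h0] at hxy
      exact ih ht (contraction_letter_injective hα _ hxy)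
    · have hcases : ∀ a b : Fin 3, a ≠ b →
          ∃ i : Fin 3, (a = i + 1 ∧ b = i + 2) ∨ (b = i + 1 ∧ a = i + 2) := by decide
      obtain ⟨i, ⟨ha, hb⟩ | ⟨ha, hb⟩⟩ := hcases _ _ h0
      · rw [ha, hb] at hxy
        exact base i _ (wordMap_mem hα hx _) _ (wordMap_mem hα hy _) hxy.symm
      · rw [ha, hb] at hxy
        exact base i _ (wordMap_mem hα hy _) _ (wordMap_mem hα hx _) hxy

/-- The last three contractions have rank one: the image of a point depends only on its side
coordinate, which lies in [0, 1] on the attractor, so they collapse the attractor onto the closed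
segments. -/
theorem mem_cell_succ {n : ℕ} {w : Fin n → Fin 3} {x : Plane} (hx : x ∈ cell hα w) :
    (∃ j : Fin 3, x ∈ cell hα (Fin.snoc w j : Fin (n + 1) → Fin 3)) ∨
      ∃ i : Fin 3, ∃ t ∈ Icc (0 : ℝ) 1, x = path α w i t := by
  obtain ⟨z, hz, rfl⟩ := hx
  obtain ⟨y, hy, ⟨j, rfl⟩ | ⟨i, rfl⟩⟩ := exists_contraction_eq hα hz
  · exact Or.inl ⟨j, y, hy, wordMap_snoc α j y w⟩
  · refine Or.inr ⟨i, _, sideCoord_mem_Icc hα i hy, ?_⟩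
    rw [contraction_side, wordMap_combo, path]

theorem mem_cell_or_path (n : ℕ) {x : Plane} (hx : x ∈ attractor hα) :
    (∃ w : Fin n → Fin 3, x ∈ cell hα w) ∨
      ∃ (m : Fin n) (w : Fin m → Fin 3) (i : Fin 3), ∃ t ∈ Icc (0 : ℝ) 1, x = path α w i t := by
  induction n with
  | zero => exact Or.inl ⟨Fin.elim0, x, hx, rfl⟩
  | succ n ih =>
    rcases ih with ⟨w, hw⟩ | ⟨m, w, i, t, ht, rfl⟩
    · rcases mem_cell_succ hα hw with ⟨j, hj⟩ | ⟨i, t, ht, hxt⟩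
      · exact Or.inl ⟨_, hj⟩
      · exact Or.inr ⟨Fin.last n, w, i, t, ht, hxt⟩
    · exact Or.inr ⟨m.castSucc, w, i, t, ht, rfl⟩

/-- Points of the attractor are separated by Lipschitz functions that are constant on each cell
of some level. -/
theorem exists_lipschitz_separating {x y : Plane} (hxy : x ≠ y) :
    ∃ φ : Plane → ℝ, LipschitzWith 1 φ ∧ φ x ≠ φ y ∧
      ∃ n : ℕ, ∀ w : Fin n → Fin 3, ∃ c, ∀ z ∈ cell hα w, φ z = c := by
  obtain ⟨n, hn⟩ := exists_dist_lt_of_mem_cell hα (dist_pos.2 hxy)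
  -- `A` is the cell of `x`, too small to contain `y`; if `x` lies in no cell of level `n`, the
  -- point itself will do.
  obtain ⟨A, hA, hxA, hyA, hcell⟩ : ∃ A : Set Plane, IsClosed A ∧ x ∈ A ∧ y ∉ A ∧
      ∀ w : Fin n → Fin 3, cell hα w ⊆ A ∨ Disjoint (cell hα w) A := by
    by_cases h : ∃ w : Fin n → Fin 3, x ∈ cell hα w
    · obtain ⟨w, hw⟩ := h
      refine ⟨cell hα w, (isCompact_cell hα w).isClosed, hw,
        fun hy => lt_irrefl _ (hn n le_rfl w x hw y hy), fun w' => ?_⟩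
      by_cases hw' : w' = w
      · exact Or.inl (hw' ▸ subset_rfl)
      · exact Or.inr (disjoint_cell hα hw')
    · push Not at h
      exact ⟨{x}, isClosed_singleton, rfl, fun hy => hxy hy.symm,
        fun w => Or.inr (disjoint_singleton_right.2 (h w))⟩
  have hne : A.Nonempty := ⟨x, hxA⟩
  have hev : ∀ᶠ δ in 𝓝[>] (0 : ℝ), ∀ w : Fin n → Fin 3, cell hα w ⊆ A ∨
      ∀ z ∈ cell hα w, δ ≤ infDist z A := by
    refine eventually_all.2 fun w => ?_
    rcases hcell w with h | h
    · exact Eventually.of_forall fun _ => Or.inl h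
    obtain ⟨z, hz, hmin⟩ := (isCompact_cell hα w).exists_isMinOn
      ((attractor_nonempty hα).image _) (continuous_infDist_pt A).continuousOn
    have hpos : 0 < infDist z A := (hA.notMem_iff_infDist_pos hne).1 (disjoint_left.1 h hz)
    filter_upwards [Ioo_mem_nhdsGT hpos] with δ hδ
    exact Or.inr fun z' hz' => hδ.2.le.trans (hmin hz')
  obtain ⟨δ, hδ, hδ0 : 0 < δ⟩ := (hev.and self_mem_nhdsWithin).exists
  -- Truncating the distance to `A` at a height below its minimum on the finitely many other cells
  -- makes it constant on each of them.
  refine ⟨fun z => min (infDist z A) δ, (lipschitz_infDist_pt A).min_const δ, ?_, n, fun w => ?_⟩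
  · have h1 : infDist x A = 0 := infDist_zero_of_mem hxA
    have h2 : 0 < infDist y A := (hA.notMem_iff_infDist_pos hne).1 hyA
    simp only [h1, min_eq_left hδ0.le]
    exact (lt_min h2 hδ0).ne
  · rcases hδ w with h | h
    · exact ⟨0, fun z hz => by simp [infDist_zero_of_mem (h hz), hδ0.le]⟩
    · exact ⟨δ, fun z hz => min_eq_right (h z hz)⟩

end Attractor

/-! ### Resistance scaling -/

theorem segLength_pos {α : ℝ} (hα : α ∈ Ioo (0 : ℝ) (1 / 3)) (m : ℕ) : 0 < segLength α m :=
  mul_pos hα.1 (pow_pos (by linarith [hα.2]) m)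

theorem rhoDiscrete_succ (α : ℝ) (n : ℕ) :
    rhoDiscrete α (n + 1) = rhoDiscrete α n * (3 / (5 + 3 * segLength α n)) :=
  Finset.prod_range_succ _ _

theorem rhoDiscrete_pos {α : ℝ} (hα : α ∈ Ioo (0 : ℝ) (1 / 3)) (n : ℕ) : 0 < rhoDiscrete α n :=
  Finset.prod_pos fun m _ => by have := segLength_pos hα m; positivity

theorem rhoSegment_pos {α : ℝ} (hα : α ∈ Ioo (0 : ℝ) (1 / 3)) (n : ℕ) : 0 < rhoSegment α n := by
  have h1 := segLength_pos hα n
  have h2 := rhoDiscrete_pos hα n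
  rw [rhoSegment]
  positivity

theorem rhoDiscrete_succ_le {α : ℝ} (hα : α ∈ Ioo (0 : ℝ) (1 / 3)) (n : ℕ) :
    rhoDiscrete α (n + 1) ≤ 3 / 5 * rhoDiscrete α n := by
  have h1 := segLength_pos hα n
  have h2 := rhoDiscrete_pos hα n
  rw [rhoDiscrete_succ, mul_comm]
  gcongr
  linarith

theorem rhoDiscrete_le_pow {α : ℝ} (hα : α ∈ Ioo (0 : ℝ) (1 / 3)) (n : ℕ) :
    rhoDiscrete α n ≤ (3 / 5) ^ n := by
  induction n with
  | zero => simp [rhoDiscrete]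
  | succ n ih =>
    rw [pow_succ]
    linarith [rhoDiscrete_succ_le hα n]

theorem rhoSegment_le {α : ℝ} (hα : α ∈ Ioo (0 : ℝ) (1 / 3)) (n : ℕ) :
    rhoSegment α n ≤ rhoDiscrete α n := by
  have h1 := segLength_pos hα n
  have h2 := rhoDiscrete_pos hα n
  refine mul_le_of_le_one_right h2.le ?_
  rw [div_le_one (by positivity)]
  linarith

/-- The network of three small triangles joined by three links has at least the energy of the
large triangle. The difference is the energy of the deviation from the harmonic extension of the
values `x`, `y`, `z` at the outer vertices. -/
theorem triangle_energy_le {d : ℝ} (hd : 0 < d) (x y z xy xz yx yz zx zy : ℝ) :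
    (x - y) ^ 2 + (y - z) ^ 2 + (z - x) ^ 2 ≤
      (5 + 3 * d) / 3 * (((x - xy) ^ 2 + (x - xz) ^ 2 + (xy - xz) ^ 2) +
        ((y - yx) ^ 2 + (y - yz) ^ 2 + (yx - yz) ^ 2) +
        ((z - zx) ^ 2 + (z - zy) ^ 2 + (zx - zy) ^ 2)) +
      (5 + 3 * d) / (3 * d) * ((xy - yx) ^ 2 + (yz - zy) ^ 2 + (zx - xz) ^ 2) := by
  set s := 5 + 3 * d with hs
  have hs0 : 0 < s := by positivity
  set xy' := xy - x + (3 * x - 2 * y - z) / s with hxy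
  set xz' := xz - x + (3 * x - 2 * z - y) / s with hxz
  set yx' := yx - y + (3 * y - 2 * x - z) / s with hyx
  set yz' := yz - y + (3 * y - 2 * z - x) / s with hyz
  set zx' := zx - z + (3 * z - 2 * x - y) / s with hzx
  set zy' := zy - z + (3 * z - 2 * y - x) / s with hzy
  -- The mixed terms cancel because the harmonic extension satisfies Kirchhoff's law at the six
  -- inner nodes.
  have key : s / 3 * (((x - xy) ^ 2 + (x - xz) ^ 2 + (xy - xz) ^ 2) +
        ((y - yx) ^ 2 + (y - yz) ^ 2 + (yx - yz) ^ 2) +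
        ((z - zx) ^ 2 + (z - zy) ^ 2 + (zx - zy) ^ 2)) +
      s / (3 * d) * ((xy - yx) ^ 2 + (yz - zy) ^ 2 + (zx - xz) ^ 2) =
      (x - y) ^ 2 + (y - z) ^ 2 + (z - x) ^ 2 +
      (s / 3 * ((xy' ^ 2 + xz' ^ 2 + (xy' - xz') ^ 2) + (yx' ^ 2 + yz' ^ 2 + (yx' - yz') ^ 2) +
        (zx' ^ 2 + zy' ^ 2 + (zx' - zy') ^ 2)) +
      s / (3 * d) * ((xy' - yx') ^ 2 + (yz' - zy') ^ 2 + (zx' - xz') ^ 2)) := by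
    rw [hxy, hxz, hyx, hyz, hzx, hzy]
    have hd' : d = (s - 5) / 3 := by rw [hs]; ring
    have hs5 : s - 5 ≠ 0 := by rw [hs]; linarith
    rw [hd']
    field_simp
    ring
  rw [key]
  exact le_add_of_nonneg_right (by positivity)

/-! ### The energy forms on functions on the attractor -/

section Energy

variable {α : ℝ} (hα : α ∈ Ioo (0 : ℝ) (1 / 3))

/-- The vertex `G_w(p_j)` as a point of the attractor. -/
noncomputable def vertex {n : ℕ} (w : Fin n → Fin 3) (j : Fin 3) : attractor hα :=
  ⟨wordMap α w (point (letter j)), wordMap_mem hα (point_mem hα _) w⟩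

theorem path_mem {m : ℕ} (w : Fin m → Fin 3) (i : Fin 3) (t : Icc (0 : ℝ) 1) :
    path α w i t ∈ attractor hα :=
  Vstar_subset hα (mem_iUnion_of_mem (m + 1) (path_mem_V α m.lt_succ_self w i t))

/-- The point of the segment `G_w(e_i)` with parameter `t`, clamped to the unit interval. -/
noncomputable def segmentPoint {m : ℕ} (w : Fin m → Fin 3) (i : Fin 3) (t : ℝ) : attractor hα :=
  ⟨path α w i (projIcc (0 : ℝ) 1 zero_le_one t), path_mem hα w i _⟩

variable (u v u' : attractor hα → ℝ)

/-- The function `u ∘ φ_e` for the segment `e = G_w(e_i)`. -/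
noncomputable def along {m : ℕ} (w : Fin m → Fin 3) (i : Fin 3) : ℝ → ℝ :=
  fun t => u (segmentPoint hα w i t)

/-- The bilinear form of the energy of level `n`. -/
noncomputable def levelForm (n : ℕ) : ℝ :=
  (rhoDiscrete α n)⁻¹ * (∑ w : Fin n → Fin 3, ∑ i : Fin 3,
    (u (vertex hα w (i + 1)) - u (vertex hα w (i + 2))) *
      (v (vertex hα w (i + 1)) - v (vertex hα w (i + 2)))) +
  ∑ m ∈ Finset.range n, (rhoSegment α m)⁻¹ * (∑ w : Fin m → Fin 3, ∑ i : Fin 3,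
    dirichlet (along hα u w i) (along hα v w i))

/-- The functions whose restriction to each segment is in `H¹`. -/
def segmentwiseH1 : Set (attractor hα → ℝ) :=
  {u | ∀ (m : ℕ) (w : Fin m → Fin 3) (i : Fin 3), IsH1 (along hα u w i)}

/-- Exchanges functions on the varying sets `V α n` for functions on the attractor; `segmentPoint`
clamps its parameter exactly as `IccExtend` does, so the two sides agree definitionally. -/
theorem levelEnergy_eq_levelForm (n : ℕ) :
    levelEnergy (restrictLevel (restrictStar hα u) n) = levelForm hα u u n := by
  rw [levelEnergy, levelForm, Finset.sum_range]
  congr 1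
  · simp only [discreteEnergy, sq]
    rfl
  · simp only [segmentEnergy, dirichlet_self]
    rfl

theorem mem_domain_iff : u ∈ domain hα ↔ Continuous u ∧ u ∈ segmentwiseH1 hα ∧
    ∃ L : ℝ, Tendsto (levelForm hα u u) atTop (𝓝 L) := by
  have h : (fun n => levelEnergy (restrictLevel (restrictStar hα u) n)) = levelForm hα u u :=
    funext fun n => levelEnergy_eq_levelForm hα u n
  simp only [domain, starDomain, mem_ofPred_eq, h]
  refine and_congr_right fun _ => and_congr_left fun _ => ⟨fun H m w i => ?_, fun H n m _ w i => ?_⟩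
  · exact H (m + 1) m m.lt_succ_self w i
  · exact H m w i

theorem levelForm_comm (n : ℕ) : levelForm hα u v n = levelForm hα v u n := by
  simp only [levelForm, mul_comm, dirichlet_comm]

theorem levelForm_nonneg (n : ℕ) : 0 ≤ levelForm hα u u n := by
  refine add_nonneg (mul_nonneg (inv_nonneg.2 (rhoDiscrete_pos hα n).le) ?_)
    (Finset.sum_nonneg fun m _ => mul_nonneg (inv_nonneg.2 (rhoSegment_pos hα m).le) ?_)
  · exact Finset.sum_nonneg fun w _ => Finset.sum_nonneg fun i _ => mul_self_nonneg _
  · exact Finset.sum_nonneg fun w _ => Finset.sum_nonneg fun i _ => dirichlet_nonneg _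

variable {u v u'}

theorem segmentwiseH1_add (hu : u ∈ segmentwiseH1 hα) (hv : v ∈ segmentwiseH1 hα) :
    u + v ∈ segmentwiseH1 hα := fun m w i => (hu m w i).add (hv m w i)

theorem segmentwiseH1_sub (hu : u ∈ segmentwiseH1 hα) (hv : v ∈ segmentwiseH1 hα) :
    u - v ∈ segmentwiseH1 hα := fun m w i => (hu m w i).sub (hv m w i)

theorem segmentwiseH1_smul (c : ℝ) (hu : u ∈ segmentwiseH1 hα) :
    c • u ∈ segmentwiseH1 hα := fun m w i => (hu m w i).const_smul c

theorem levelForm_add_left (hu : u ∈ segmentwiseH1 hα) (hv : v ∈ segmentwiseH1 hα)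
    (hu' : u' ∈ segmentwiseH1 hα) (n : ℕ) :
    levelForm hα (u + v) u' n = levelForm hα u u' n + levelForm hα v u' n := by
  have h : ∀ (m : ℕ) (w : Fin m → Fin 3) (i : Fin 3),
      dirichlet (along hα (u + v) w i) (along hα u' w i) =
        dirichlet (along hα u w i) (along hα u' w i) +
          dirichlet (along hα v w i) (along hα u' w i) :=
    fun m w i => (hu m w i).dirichlet_add_left (hv m w i) (hu' m w i)
  simp only [levelForm, h, Pi.add_apply, add_sub_add_comm, add_mul, Finset.sum_add_distrib, mul_add]
  ring

theorem levelForm_smul_left (c : ℝ) (u v : attractor hα → ℝ) (n : ℕ) :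
    levelForm hα (c • u) v n = c * levelForm hα u v n := by
  have h : ∀ (m : ℕ) (w : Fin m → Fin 3) (i : Fin 3),
      dirichlet (along hα (c • u) w i) (along hα v w i) =
        c * dirichlet (along hα u w i) (along hα v w i) :=
    fun m w i => dirichlet_smul_left c _ _
  simp only [levelForm, h, Pi.smul_apply, smul_eq_mul, ← mul_sub, mul_assoc, ← Finset.mul_sum,
    mul_left_comm _ c, mul_add]

theorem levelForm_add_add (hu : u ∈ segmentwiseH1 hα) (hv : v ∈ segmentwiseH1 hα) (n : ℕ) :
    levelForm hα (u + v) (u + v) n =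
      levelForm hα u u n + 2 * levelForm hα u v n + levelForm hα v v n := by
  have huv := segmentwiseH1_add hα hu hv
  rw [levelForm_add_left hα hu hv huv, levelForm_comm hα u, levelForm_comm hα v,
    levelForm_add_left hα hu hv hu, levelForm_add_left hα hu hv hv, levelForm_comm hα v u]
  ring

/-- Half of the parallelogram law: the form is non-negative at u - v. -/
theorem levelForm_add_le (hu : u ∈ segmentwiseH1 hα) (hv : v ∈ segmentwiseH1 hα) (n : ℕ) :
    levelForm hα (u + v) (u + v) n ≤ 2 * levelForm hα u u n + 2 * levelForm hα v v n := by
  have hv' := segmentwiseH1_smul hα (-1) hv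
  have h1 := levelForm_nonneg hα (u + (-1 : ℝ) • v) n
  rw [levelForm_add_add hα hu hv', levelForm_smul_left hα (-1) v,
    levelForm_comm hα u ((-1 : ℝ) • v), levelForm_comm hα v ((-1 : ℝ) • v),
    levelForm_smul_left hα (-1) v, levelForm_smul_left hα (-1) v, levelForm_comm hα v u] at h1
  rw [levelForm_add_add hα hu hv]
  linarith

/-! ### Comparison of consecutive levels -/

theorem vertex_snoc {n : ℕ} (w : Fin n → Fin 3) (j : Fin 3) :
    vertex hα (Fin.snoc w j : Fin (n + 1) → Fin 3) j = vertex hα w j :=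
  Subtype.ext (wordMap_snoc_point α w j)

theorem segmentPoint_zero {m : ℕ} (w : Fin m → Fin 3) (i : Fin 3) :
    segmentPoint hα w i 0 = vertex hα (Fin.snoc w (i + 1) : Fin (m + 1) → Fin 3) (i + 2) := by
  refine Subtype.ext ?_
  simp only [segmentPoint, projIcc_left, vertex, path_zero]

theorem segmentPoint_one {m : ℕ} (w : Fin m → Fin 3) (i : Fin 3) :
    segmentPoint hα w i 1 = vertex hα (Fin.snoc w (i + 2) : Fin (m + 1) → Fin 3) (i + 1) := by
  refine Subtype.ext ?_
  simp only [segmentPoint, projIcc_right, vertex, path_one]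

theorem sum_snoc {n : ℕ} (f : (Fin (n + 1) → Fin 3) → ℝ) :
    ∑ w, f w = ∑ w : Fin n → Fin 3, ∑ j : Fin 3, f (Fin.snoc w j) := by
  rw [← (Fin.snocEquiv fun _ : Fin (n + 1) => Fin 3).sum_comp, Fintype.sum_prod_type,
    Finset.sum_comm]
  rfl

/-- Replacing each new segment by a link between its ends only lowers the energy of level n + 1;
then `triangle_energy_le` applies to each word, its coefficients being the ratios of the scaling
factors (`e1`, `e2`). -/
theorem levelForm_monotone (hu : u ∈ segmentwiseH1 hα) : Monotone (levelForm hα u u) := by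
  refine monotone_nat_of_le_succ fun n => ?_
  have hd := segLength_pos hα n
  have hρ := rhoDiscrete_pos hα n
  simp only [levelForm, Finset.sum_range_succ, sum_snoc]
  set d := segLength α n with hd_def
  have e1 : (rhoDiscrete α (n + 1))⁻¹ = (rhoDiscrete α n)⁻¹ * ((5 + 3 * d) / 3) := by
    rw [rhoDiscrete_succ, mul_inv, inv_div]
  have e2 : (rhoSegment α n)⁻¹ = (rhoDiscrete α n)⁻¹ * ((5 + 3 * d) / (3 * d)) := by
    rw [rhoSegment, mul_inv, inv_div]
  have key : ∀ w : Fin n → Fin 3, ∑ i : Fin 3,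
      (u (vertex hα w (i + 1)) - u (vertex hα w (i + 2))) *
        (u (vertex hα w (i + 1)) - u (vertex hα w (i + 2))) ≤
      (5 + 3 * d) / 3 * (∑ j : Fin 3, ∑ i : Fin 3,
        (u (vertex hα (Fin.snoc w j : Fin (n + 1) → Fin 3) (i + 1)) -
          u (vertex hα (Fin.snoc w j : Fin (n + 1) → Fin 3) (i + 2))) *
        (u (vertex hα (Fin.snoc w j : Fin (n + 1) → Fin 3) (i + 1)) -
          u (vertex hα (Fin.snoc w j : Fin (n + 1) → Fin 3) (i + 2)))) +
      (5 + 3 * d) / (3 * d) * ∑ i : Fin 3, dirichlet (along hα u w i) (along hα u w i) := by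
    intro w
    have hseg : ∀ i : Fin 3, (u (vertex hα (Fin.snoc w (i + 2) : Fin (n + 1) → Fin 3) (i + 1)) -
        u (vertex hα (Fin.snoc w (i + 1) : Fin (n + 1) → Fin 3) (i + 2))) ^ 2 ≤
        dirichlet (along hα u w i) (along hα u w i) := by
      intro i
      have := (hu n w i).sq_sub_le (left_mem_Icc.2 zero_le_one) (right_mem_Icc.2 zero_le_one)
      simpa only [along, segmentPoint_zero, segmentPoint_one, sub_zero, abs_one, one_mul] using this
    have hsum := Finset.sum_le_sum fun i (_ : i ∈ Finset.univ) => hseg i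
    refine le_trans ?_ (add_le_add_right (mul_le_mul_of_nonneg_left hsum (by positivity)) _)
    have h12 : (1 : Fin 3) + 2 = 0 := rfl
    have h21 : (2 : Fin 3) + 1 = 0 := rfl
    have h22 : (2 : Fin 3) + 2 = 1 := rfl
    have h11 : (1 : Fin 3) + 1 = 2 := rfl
    -- `vertex_snoc` identifies the outer corner of the j-th small triangle with the j-th vertex of
    -- the large one.
    simp only [Fin.sum_univ_three, zero_add, h12, h21, h22, h11, vertex_snoc]
    refine le_trans (le_of_eq ?_) ((triangle_energy_le hd (u (vertex hα w 0)) (u (vertex hα w 1))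
      (u (vertex hα w 2)) (u (vertex hα (Fin.snoc w 0 : Fin (n + 1) → Fin 3) 1))
      (u (vertex hα (Fin.snoc w 0 : Fin (n + 1) → Fin 3) 2))
      (u (vertex hα (Fin.snoc w 1 : Fin (n + 1) → Fin 3) 0))
      (u (vertex hα (Fin.snoc w 1 : Fin (n + 1) → Fin 3) 2))
      (u (vertex hα (Fin.snoc w 2 : Fin (n + 1) → Fin 3) 0))
      (u (vertex hα (Fin.snoc w 2 : Fin (n + 1) → Fin 3) 1))).trans (le_of_eq ?_))
    · ring
    · ring
  have hsum := mul_le_mul_of_nonneg_left (Finset.sum_le_sum fun w (_ : w ∈ Finset.univ) => key w)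
    (inv_pos.2 hρ).le
  rw [Finset.sum_add_distrib, ← Finset.mul_sum, ← Finset.mul_sum, mul_add, ← mul_assoc,
    ← mul_assoc, ← e1, ← e2] at hsum
  linarith

/-! ### Bounds for a single edge or segment -/

theorem sq_sub_vertex_le (u : attractor hα → ℝ) {n : ℕ} (w : Fin n → Fin 3) (j k : Fin 3) :
    (u (vertex hα w j) - u (vertex hα w k)) ^ 2 ≤ rhoDiscrete α n * levelForm hα u u n := by
  have hρ := rhoDiscrete_pos hα n
  have h1 : ∀ i : Fin 3, (u (vertex hα w (i + 1)) - u (vertex hα w (i + 2))) ^ 2 ≤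
      rhoDiscrete α n * levelForm hα u u n := by
    intro i
    rw [levelForm, mul_add, mul_inv_cancel_left₀ hρ.ne']
    refine le_add_of_le_of_nonneg ?_ (mul_nonneg hρ.le (Finset.sum_nonneg fun m _ =>
      mul_nonneg (inv_nonneg.2 (rhoSegment_pos hα m).le)
        (Finset.sum_nonneg fun w _ => Finset.sum_nonneg fun i _ => dirichlet_nonneg _)))
    rw [sq]
    refine (Finset.single_le_sum (f := fun i : Fin 3 =>
        (u (vertex hα w (i + 1)) - u (vertex hα w (i + 2))) *
          (u (vertex hα w (i + 1)) - u (vertex hα w (i + 2))))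
        (fun i _ => mul_self_nonneg _) (Finset.mem_univ i)).trans
      (Finset.single_le_sum (f := fun w : Fin n → Fin 3 => ∑ i : Fin 3,
        (u (vertex hα w (i + 1)) - u (vertex hα w (i + 2))) *
          (u (vertex hα w (i + 1)) - u (vertex hα w (i + 2))))
        (fun w _ => Finset.sum_nonneg fun i _ => mul_self_nonneg _) (Finset.mem_univ w))
  have hcases : ∀ a b : Fin 3, a = b ∨
      ∃ i : Fin 3, (a = i + 1 ∧ b = i + 2) ∨ (b = i + 1 ∧ a = i + 2) := by decide
  rcases hcases j k with rfl | ⟨i, ⟨rfl, rfl⟩ | ⟨rfl, rfl⟩⟩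
  · rw [sub_self, zero_pow two_ne_zero]
    exact mul_nonneg hρ.le (levelForm_nonneg hα u n)
  · exact h1 i
  · rw [← neg_sub, neg_sq]
    exact h1 i

theorem dirichlet_along_le (u : attractor hα → ℝ) {m n : ℕ} (h : m < n) (w : Fin m → Fin 3)
    (i : Fin 3) :
    dirichlet (along hα u w i) (along hα u w i) ≤ rhoSegment α m * levelForm hα u u n := by
  have hρ := rhoSegment_pos hα m
  rw [← inv_mul_le_iff₀ hρ]
  refine le_add_of_nonneg_of_le (mul_nonneg (inv_nonneg.2 (rhoDiscrete_pos hα n).le)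
    (Finset.sum_nonneg fun w _ => Finset.sum_nonneg fun i _ => mul_self_nonneg _)) ?_
  refine le_trans ?_ (Finset.single_le_sum (fun m _ =>
      mul_nonneg (inv_nonneg.2 (rhoSegment_pos hα m).le)
        (Finset.sum_nonneg fun w _ => Finset.sum_nonneg fun i _ => dirichlet_nonneg _))
      (Finset.mem_range.2 h))
  refine mul_le_mul_of_nonneg_left ?_ (inv_nonneg.2 hρ.le)
  exact (Finset.single_le_sum (fun i _ => dirichlet_nonneg (along hα u w i))
      (Finset.mem_univ i)).trans
    (Finset.single_le_sum (f := fun w : Fin m → Fin 3 => ∑ i : Fin 3,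
      dirichlet (along hα u w i) (along hα u w i))
      (fun w _ => Finset.sum_nonneg fun i _ => dirichlet_nonneg _) (Finset.mem_univ w))


instance compactSpace_attractor : CompactSpace (attractor hα) :=
  isCompact_iff_compactSpace.1 (attractor_isCompact hα)

/-! ### Oscillation on cells -/

theorem vertex_mem_cell {n : ℕ} (w : Fin n → Fin 3) (j : Fin 3) :
    (vertex hα w j : Plane) ∈ cell hα w :=
  mem_image_of_mem _ (point_mem hα _)

theorem coe_segmentPoint {m : ℕ} (w : Fin m → Fin 3) (i : Fin 3) {t : ℝ}
    (ht : t ∈ Icc (0 : ℝ) 1) : (segmentPoint hα w i t : Plane) = path α w i t := by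
  simp only [segmentPoint, projIcc_of_mem zero_le_one ht]

theorem eq_segmentPoint {m : ℕ} {w : Fin m → Fin 3} {i : Fin 3} {t : ℝ}
    (ht : t ∈ Icc (0 : ℝ) 1) {x : attractor hα} (hx : (x : Plane) = path α w i t) :
    x = segmentPoint hα w i t :=
  Subtype.ext (hx.trans (coe_segmentPoint hα w i ht).symm)

/-- On a cell of level `n`, a function of energy `E` deviates from its values at the vertices by
at most `5 √(ρ_n E)`. -/
theorem abs_sub_vertex_le (hc : Continuous u) (hu : u ∈ segmentwiseH1 hα) {E : ℝ}
    (hE : ∀ n, levelForm hα u u n ≤ E) {n : ℕ} {w : Fin n → Fin 3} (j : Fin 3)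
    {x : attractor hα} (hx : (x : Plane) ∈ cell hα w) :
    |u x - u (vertex hα w j)| ≤ 5 * √(rhoDiscrete α n * E) := by
  refine le_of_forall_pos_le_add fun ε hε => ?_
  obtain ⟨δ, hδ, hδu⟩ := Metric.uniformContinuous_iff.1
    (CompactSpace.uniformContinuous_of_continuous hc) ε hε
  obtain ⟨N, hN⟩ := exists_dist_lt_of_mem_cell hα hδ
  -- Downward induction on the level: from level `N` on, cells are so small that uniform continuity
  -- of `u` gives the error `ε`; coarser levels follow by chaining.
  suffices H : ∀ k n : ℕ, N ≤ n + k → ∀ (w : Fin n → Fin 3) (j : Fin 3) (x : attractor hα),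
      (x : Plane) ∈ cell hα w →
      |u x - u (vertex hα w j)| ≤ 5 * √(rhoDiscrete α n * E) + ε from
    H N n (Nat.le_add_left N n) w j x hx
  clear hx x j w n
  have hE0 : 0 ≤ E := (levelForm_nonneg hα u 0).trans (hE 0)
  have hedge : ∀ {n : ℕ} (w : Fin n → Fin 3) (j k : Fin 3),
      |u (vertex hα w j) - u (vertex hα w k)| ≤ √(rhoDiscrete α n * E) := fun w j k =>
    Real.abs_le_sqrt ((sq_sub_vertex_le hα u w j k).trans
      (mul_le_mul_of_nonneg_left (hE _) (rhoDiscrete_pos hα _).le))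
  intro k
  induction k with
  | zero =>
    intro n hn w j x hx
    have := hδu (a := x) (b := vertex hα w j) (hN n hn w x hx _ (vertex_mem_cell hα w j))
    rw [Real.dist_eq] at this
    have := Real.sqrt_nonneg (rhoDiscrete α n * E)
    linarith
  | succ k ih =>
    intro n hn w j x hx
    -- √(3/5) ≤ 4/5, as 3/5 ≤ 16/25.
    have hstep : √(rhoDiscrete α (n + 1) * E) ≤ 4 / 5 * √(rhoDiscrete α n * E) := by
      rw [show (4 / 5 : ℝ) = √(16 / 25) by
        rw [show (16 / 25 : ℝ) = (4 / 5) ^ 2 by norm_num, Real.sqrt_sq (by norm_num)],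
        ← Real.sqrt_mul (by norm_num), ← mul_assoc]
      refine Real.sqrt_le_sqrt (mul_le_mul_of_nonneg_right ?_ hE0)
      linarith [rhoDiscrete_succ_le hα n, rhoDiscrete_pos hα n]
    have hs0 := Real.sqrt_nonneg (rhoDiscrete α n * E)
    rcases mem_cell_succ hα hx with ⟨j', hj'⟩ | ⟨i, t, ht, hxt⟩
    -- From the subcell's vertex one edge of level n remains: 5 · 4/5 + 1 = 5, which fixes the
    -- constant.
    · have h1 := ih (n + 1) (by omega) _ j' x hj'
      rw [vertex_snoc] at h1
      have h2 := hedge w j' j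
      have h3 := abs_sub_le (u x) (u (vertex hα w j')) (u (vertex hα w j))
      linarith
    -- On a segment: go to its initial point, then along a small edge and a large edge, for a total
    -- of 1 + 4/5 + 1 ≤ 5.
    · have h1 : |u x - u (vertex hα (Fin.snoc w (i + 1) : Fin (n + 1) → Fin 3) (i + 2))| ≤
          √(rhoDiscrete α n * E) := by
        refine Real.abs_le_sqrt ?_
        rw [eq_segmentPoint hα ht hxt, ← segmentPoint_zero]
        refine ((hu n w i).sq_sub_le (left_mem_Icc.2 zero_le_one) ht).trans ?_
        have hd := dirichlet_along_le hα u n.lt_succ_self w i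
        have hd0 := dirichlet_nonneg (along hα u w i)
        have h2 : rhoSegment α n * levelForm hα u u (n + 1) ≤ rhoDiscrete α n * E :=
          mul_le_mul (rhoSegment_le hα n) (hE _) (levelForm_nonneg hα u _)
            (rhoDiscrete_pos hα n).le
        rw [sub_zero, abs_of_nonneg ht.1]
        exact (mul_le_of_le_one_left hd0 ht.2).trans (hd.trans h2)
      have h2 := hedge (Fin.snoc w (i + 1) : Fin (n + 1) → Fin 3) (i + 2) (i + 1)
      have h3 := hedge w (i + 1) j
      rw [vertex_snoc] at h2
      have h4 := abs_sub_le (u x) (u (vertex hα (Fin.snoc w (i + 1) : Fin (n + 1) → Fin 3) (i + 2)))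
        (u (vertex hα w j))
      have h5 := abs_sub_le (u (vertex hα (Fin.snoc w (i + 1) : Fin (n + 1) → Fin 3) (i + 2)))
        (u (vertex hα w (i + 1))) (u (vertex hα w j))
      linarith

/-- Comparison through a common vertex; 100 = (5 + 5)². -/
theorem sq_sub_le_of_mem_cell (hc : Continuous u) (hu : u ∈ segmentwiseH1 hα) {E : ℝ}
    (hE : ∀ n, levelForm hα u u n ≤ E) {n : ℕ} {w : Fin n → Fin 3}
    {x y : attractor hα} (hx : (x : Plane) ∈ cell hα w) (hy : (y : Plane) ∈ cell hα w) :
    (u x - u y) ^ 2 ≤ 100 * (rhoDiscrete α n * E) := by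
  have h1 := abs_sub_vertex_le hα hc hu hE 0 hx
  have h2 := abs_sub_vertex_le hα hc hu hE 0 hy
  rw [abs_sub_comm] at h2
  have h3 := abs_sub_le (u x) (u (vertex hα w 0)) (u y)
  have hE0 : 0 ≤ E := (levelForm_nonneg hα u 0).trans (hE 0)
  have h4 := Real.sq_sqrt (mul_nonneg (rhoDiscrete_pos hα n).le hE0)
  have h5 : |u x - u y| ≤ 10 * √(rhoDiscrete α n * E) := by linarith
  rw [← sq_abs, ← h4]
  calc |u x - u y| ^ 2 ≤ (10 * √(rhoDiscrete α n * E)) ^ 2 := by gcongr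
    _ = _ := by ring

/-- The attractor is the cell of the empty word, and ρ_0 = 1. -/
theorem sq_sub_le_levelForm (hc : Continuous u) (hu : u ∈ segmentwiseH1 hα) {E : ℝ}
    (hE : ∀ n, levelForm hα u u n ≤ E) (x y : attractor hα) : (u x - u y) ^ 2 ≤ 100 * E := by
  have h := sq_sub_le_of_mem_cell hα hc hu hE (w := (Fin.elim0 : Fin 0 → Fin 3))
    (x := x) (y := y) ⟨x, x.2, rfl⟩ ⟨y, y.2, rfl⟩
  simpa [rhoDiscrete] using h

/-! ### The domain -/

/-- Bounded monotone sequences converge, so membership never requires exhibiting the limit. -/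
theorem mem_domain_of_le (hc : Continuous u) (hu : u ∈ segmentwiseH1 hα) {C : ℝ}
    (hC : ∀ n, levelForm hα u u n ≤ C) : u ∈ domain hα :=
  (mem_domain_iff hα u).2 ⟨hc, hu, _, tendsto_atTop_ciSup (levelForm_monotone hα hu)
    ⟨C, forall_mem_range.2 hC⟩⟩

theorem tendsto_levelForm_energy (hu : u ∈ domain hα) :
    Tendsto (levelForm hα u u) atTop (𝓝 (energy hα u)) := by
  have h : (fun n => levelEnergy (restrictLevel (restrictStar hα u) n)) = levelForm hα u u :=
    funext fun n => levelEnergy_eq_levelForm hα u n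
  rw [energy, starEnergy, h]
  exact tendsto_nhds_limUnder ((mem_domain_iff hα u).1 hu).2.2

theorem segmentwiseH1_of_mem_domain (hu : u ∈ domain hα) : u ∈ segmentwiseH1 hα :=
  ((mem_domain_iff hα u).1 hu).2.1

theorem levelForm_le_energy (hu : u ∈ domain hα) (n : ℕ) : levelForm hα u u n ≤ energy hα u :=
  (levelForm_monotone hα (segmentwiseH1_of_mem_domain hα hu)).ge_of_tendsto
    (tendsto_levelForm_energy hα hu) n

theorem energy_le (hu : u ∈ domain hα) {C : ℝ} (hC : ∀ n, levelForm hα u u n ≤ C) :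
    energy hα u ≤ C :=
  le_of_tendsto' (tendsto_levelForm_energy hα hu) hC

theorem energy_nonneg (hu : u ∈ domain hα) : 0 ≤ energy hα u :=
  (levelForm_nonneg hα u 0).trans (levelForm_le_energy hα hu 0)

theorem sq_sub_le_energy (hu : u ∈ domain hα) (x y : attractor hα) :
    (u x - u y) ^ 2 ≤ 100 * energy hα u :=
  sq_sub_le_levelForm hα hu.1 (segmentwiseH1_of_mem_domain hα hu) (levelForm_le_energy hα hu) x y

theorem levelForm_const (c : ℝ) (v : attractor hα → ℝ) (n : ℕ) :
    levelForm hα (fun _ => c) v n = 0 := by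
  have h : ∀ (m : ℕ) (w : Fin m → Fin 3) (i : Fin 3), along hα (fun _ => c) w i = fun _ => c :=
    fun _ _ _ => rfl
  simp [levelForm, h, dirichlet_const]

theorem const_mem_domain (c : ℝ) : (fun _ => c) ∈ domain hα :=
  mem_domain_of_le hα continuous_const (fun _ _ _ => IsH1.const c)
    fun n => (levelForm_const hα c _ n).le

theorem energy_const (c : ℝ) : energy hα (fun _ => c) = 0 :=
  le_antisymm (energy_le hα (const_mem_domain hα c) fun n => (levelForm_const hα c _ n).le)
    (energy_nonneg hα (const_mem_domain hα c))

theorem add_mem_domain (hu : u ∈ domain hα) (hv : v ∈ domain hα) : u + v ∈ domain hα := by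
  have hu1 := segmentwiseH1_of_mem_domain hα hu
  have hv1 := segmentwiseH1_of_mem_domain hα hv
  refine mem_domain_of_le hα (hu.1.add hv.1) (segmentwiseH1_add hα hu1 hv1)
    (C := 2 * energy hα u + 2 * energy hα v) fun n => ?_
  have := levelForm_add_le hα hu1 hv1 n
  linarith [levelForm_le_energy hα hu n, levelForm_le_energy hα hv n]

theorem smul_mem_domain (c : ℝ) (hu : u ∈ domain hα) : c • u ∈ domain hα := by
  refine mem_domain_of_le hα (hu.1.const_smul c)
    (segmentwiseH1_smul hα c (segmentwiseH1_of_mem_domain hα hu)) (C := c * (c * energy hα u))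
    fun n => ?_
  rw [levelForm_smul_left, levelForm_comm, levelForm_smul_left, ← mul_assoc, ← mul_assoc]
  exact mul_le_mul_of_nonneg_left (levelForm_le_energy hα hu n) (mul_self_nonneg c)

theorem sub_mem_domain (hu : u ∈ domain hα) (hv : v ∈ domain hα) : u - v ∈ domain hα := by
  have := add_mem_domain hα hu (smul_mem_domain hα (-1) hv)
  rwa [neg_one_smul, ← sub_eq_add_neg] at this

/-- Polarization holds at every level, so the algebraic identities for `form` follow from those of
`levelForm` by uniqueness of limits. -/
theorem tendsto_levelForm_form (hu : u ∈ domain hα) (hv : v ∈ domain hα) :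
    Tendsto (levelForm hα u v) atTop (𝓝 (form hα u v)) := by
  have h := (((tendsto_levelForm_energy hα (add_mem_domain hα hu hv)).sub
    (tendsto_levelForm_energy hα hu)).sub (tendsto_levelForm_energy hα hv)).const_mul (1 / 2)
  refine h.congr fun n => ?_
  rw [levelForm_add_add hα (segmentwiseH1_of_mem_domain hα hu) (segmentwiseH1_of_mem_domain hα hv)]
  ring

theorem form_self (hu : u ∈ domain hα) : form hα u u = energy hα u :=
  tendsto_nhds_unique (tendsto_levelForm_form hα hu hu) (tendsto_levelForm_energy hα hu)

/-- Every term of the level energy decreases separately. Truncation to [0, 1] gives the Markov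
property, the positive part the lattice operations. -/
theorem comp_lipschitz_mem_domain (hu : u ∈ domain hα) {φ : ℝ → ℝ} (hφ : LipschitzWith 1 φ) :
    φ ∘ u ∈ domain hα ∧ energy hα (φ ∘ u) ≤ energy hα u := by
  have hu1 := segmentwiseH1_of_mem_domain hα hu
  have hle : ∀ n, levelForm hα (φ ∘ u) (φ ∘ u) n ≤ energy hα u := by
    refine fun n => le_trans ?_ (levelForm_le_energy hα hu n)
    refine add_le_add (mul_le_mul_of_nonneg_left ?_ (inv_pos.2 (rhoDiscrete_pos hα n)).le)
      (Finset.sum_le_sum fun m _ =>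
        mul_le_mul_of_nonneg_left ?_ (inv_pos.2 (rhoSegment_pos hα m)).le)
    · refine Finset.sum_le_sum fun w _ => Finset.sum_le_sum fun i _ => ?_
      rw [← sq, ← sq, sq_le_sq]
      simpa using hφ.norm_sub_le (u (vertex hα w (i + 1))) (u (vertex hα w (i + 2)))
    · exact Finset.sum_le_sum fun w _ => Finset.sum_le_sum fun i _ =>
        ((hu1 m w i).comp_lipschitz hφ).2
  have hmem : φ ∘ u ∈ domain hα := mem_domain_of_le hα (hφ.continuous.comp hu.1)
    (fun m w i => ((hu1 m w i).comp_lipschitz hφ).1) hle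
  exact ⟨hmem, energy_le hα hmem hle⟩

/-! ### Separating functions of finite energy -/

theorem exists_eq_of_mem_cell_of_le {φ : Plane → ℝ} {n : ℕ}
    (h : ∀ w : Fin n → Fin 3, ∃ c, ∀ z ∈ cell hα w, φ z = c) {m : ℕ} (hnm : n ≤ m)
    (w : Fin m → Fin 3) : ∃ c, ∀ z ∈ cell hα w, φ z = c := by
  induction m, hnm using Nat.le_induction with
  | base => exact h w
  | succ m _ ih =>
    obtain ⟨c, hc⟩ := ih (Fin.init w)
    refine ⟨c, ?_⟩
    rintro _ ⟨z, hz, rfl⟩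
    refine hc _ ⟨contraction α (letter (w (Fin.last m))) z, contraction_mem hα hz _, ?_⟩
    rw [← wordMap_snoc, Fin.snoc_init_self]

theorem segmentPoint_mem_cell {m : ℕ} (w : Fin m → Fin 3) (i : Fin 3) (t : ℝ) :
    (segmentPoint hα w i t : Plane) ∈ cell hα w := by
  obtain ⟨z, hz, hzt⟩ := exists_sideCoord_eq hα i (projIcc (0 : ℝ) 1 zero_le_one t).2
  refine ⟨_, contraction_mem hα hz (Fin.natAdd 3 i), ?_⟩
  rw [contraction_side, hzt, wordMap_combo]
  rfl

theorem lipschitz_segmentPoint {m : ℕ} (w : Fin m → Fin 3) (i : Fin 3) :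
    LipschitzWith ‖wordMap α w (segEnd α i) - wordMap α w (segStart α i)‖₊
      (segmentPoint hα w i) := by
  refine LipschitzWith.of_dist_le_mul fun s t => ?_
  rw [Subtype.dist_eq, dist_eq_norm]
  change ‖path α w i _ - path α w i _‖ ≤ _
  rw [path_sub, norm_smul, mul_comm, coe_nnnorm]
  refine mul_le_mul_of_nonneg_left ?_ (norm_nonneg _)
  have := (LipschitzWith.projIcc (zero_le_one (α := ℝ))).dist_le_mul s t
  rwa [NNReal.coe_one, one_mul] at this

/-- Lipschitz functions that are constant on each cell of some level have finite energy. -/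
theorem lipschitz_mem_domain {φ : Plane → ℝ} (hφ : LipschitzWith 1 φ) {n : ℕ}
    (h : ∀ w : Fin n → Fin 3, ∃ c, ∀ z ∈ cell hα w, φ z = c) :
    (fun x : attractor hα => φ x) ∈ domain hα := by
  set u : attractor hα → ℝ := fun x => φ x
  have hu : LipschitzWith 1 u := LipschitzWith.of_dist_le_mul fun x y => hφ.dist_le_mul x y
  have hu1 : u ∈ segmentwiseH1 hα := fun m w i =>
    IsH1.of_lipschitz (hu.comp (lipschitz_segmentPoint hα w i))
  have hcell : ∀ m ≥ n, ∀ (w : Fin m → Fin 3), ∃ c, ∀ x : attractor hα,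
      (x : Plane) ∈ cell hα w → u x = c := fun m hm w =>
    (exists_eq_of_mem_cell_of_le hα h hm w).imp fun c hc x hx => hc x hx
  refine mem_domain_of_le hα hu.continuous hu1 (C := levelForm hα u u n) fun m => ?_
  rcases le_total m n with hmn | hnm
  · exact levelForm_monotone hα hu1 hmn
  -- Beyond level `n` the triangle terms vanish and new segments, lying inside cells, contribute
  -- nothing.
  have h1 : ∀ w : Fin m → Fin 3, ∀ j k : Fin 3,
      u (vertex hα w j) - u (vertex hα w k) = 0 := by
    intro w j k
    obtain ⟨c, hc⟩ := hcell m hnm w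
    rw [hc _ (vertex_mem_cell hα w j), hc _ (vertex_mem_cell hα w k), sub_self]
  have h2 : ∑ k ∈ Finset.range m, (rhoSegment α k)⁻¹ * (∑ w : Fin k → Fin 3, ∑ i : Fin 3,
      dirichlet (along hα u w i) (along hα u w i)) =
      ∑ k ∈ Finset.range n, (rhoSegment α k)⁻¹ * (∑ w : Fin k → Fin 3, ∑ i : Fin 3,
      dirichlet (along hα u w i) (along hα u w i)) := by
    refine (Finset.sum_subset (Finset.range_subset_range.2 hnm) fun k _ hk => ?_).symm
    rw [Finset.mem_range, not_lt] at hk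
    refine mul_eq_zero_of_right _ (Finset.sum_eq_zero fun w _ => Finset.sum_eq_zero fun i _ => ?_)
    obtain ⟨c, hc⟩ := hcell k hk w
    have : along hα u w i = fun _ => c := funext fun t => hc _ (segmentPoint_mem_cell hα w i t)
    rw [this, dirichlet_const]
  rw [levelForm, h2]
  simp only [h1, mul_zero, Finset.sum_const_zero, zero_add]
  exact le_add_of_nonneg_left (mul_nonneg (inv_nonneg.2 (rhoDiscrete_pos hα n).le)
    (Finset.sum_nonneg fun w _ => Finset.sum_nonneg fun i _ => mul_self_nonneg _))

theorem exists_mem_domain_ne {x y : attractor hα} (hxy : x ≠ y) : ∃ u ∈ domain hα, u x ≠ u y := by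
  obtain ⟨φ, hφ, hne, n, hn⟩ := exists_lipschitz_separating hα fun h => hxy (Subtype.ext h)
  exact ⟨_, lipschitz_mem_domain hα hφ hn, hne⟩


/-! ### Completeness -/

theorem energy_add_const (hu : u ∈ domain hα) (c : ℝ) :
    energy hα (u + fun _ => c) = energy hα u := by
  have hc := const_mem_domain hα c
  refine tendsto_nhds_unique (tendsto_levelForm_energy hα (add_mem_domain hα hu hc))
    ((tendsto_levelForm_energy hα hu).congr fun n => ?_)
  rw [levelForm_add_add hα (segmentwiseH1_of_mem_domain hα hu) (segmentwiseH1_of_mem_domain hα hc),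
    levelForm_comm hα u (fun _ => c), levelForm_const, levelForm_const]
  ring

theorem dirichlet_along_le_energy (hu : u ∈ domain hα) {m : ℕ} (w : Fin m → Fin 3) (i : Fin 3) :
    dirichlet (along hα u w i) (along hα u w i) ≤ energy hα u := by
  have h1 : rhoSegment α m ≤ 1 := (rhoSegment_le hα m).trans
    ((rhoDiscrete_le_pow hα m).trans (pow_le_one₀ (by norm_num) (by norm_num)))
  refine (dirichlet_along_le hα u m.lt_succ_self w i).trans ?_
  exact (mul_le_of_le_one_left (levelForm_nonneg hα u _) h1).trans (levelForm_le_energy hα hu _)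

/-- An energy-Cauchy sequence in the domain that converges pointwise to a continuous function
converges in energy. -/
theorem mem_domain_of_tendsto {f : ℕ → attractor hα → ℝ} (hf : ∀ n, f n ∈ domain hα)
    (hv : Continuous v) (hfv : ∀ x, Tendsto (fun n => f n x) atTop (𝓝 (v x)))
    (hc : ∀ ε > 0, ∃ N, ∀ m ≥ N, ∀ n ≥ N, energy hα (f m - f n) < ε) :
    v ∈ domain hα ∧ Tendsto (fun n => energy hα (f n - v)) atTop (𝓝 0) := by
  have hf1 := fun n => segmentwiseH1_of_mem_domain hα (hf n)
  have hsub := fun m n => sub_mem_domain hα (hf m) (hf n)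
  have hlim : ∀ (m : ℕ) (w : Fin m → Fin 3) (i : Fin 3), IsH1 (along hα v w i) ∧
      Tendsto (fun n => dirichlet (along hα (f n) w i - along hα v w i)
        (along hα (f n) w i - along hα v w i)) atTop (𝓝 0) := by
    intro m w i
    refine IsH1.of_tendsto (fun n => hf1 n m w i) (fun t _ => hfv _) fun ε hε => ?_
    obtain ⟨N, hN⟩ := hc ε hε
    exact ⟨N, fun k hk l hl => (dirichlet_along_le_energy hα (hsub k l) w i).trans_lt (hN k hk l hl)⟩
  have hv1 : v ∈ segmentwiseH1 hα := fun m w i => (hlim m w i).1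
  -- A fixed level involves finitely many vertices and segments, so convergence of each term
  -- suffices.
  have hlevel : ∀ n, Tendsto (fun k => levelForm hα (f k - v) (f k - v) n) atTop (𝓝 0) := by
    intro n
    have hpt : ∀ x, Tendsto (fun k => (f k - v) x) atTop (𝓝 0) := fun x => by
      simpa using (hfv x).sub_const (v x)
    have h1 : Tendsto (fun k => ∑ w : Fin n → Fin 3, ∑ i : Fin 3,
        ((f k - v) (vertex hα w (i + 1)) - (f k - v) (vertex hα w (i + 2))) *
        ((f k - v) (vertex hα w (i + 1)) - (f k - v) (vertex hα w (i + 2)))) atTop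
        (𝓝 (∑ w : Fin n → Fin 3, ∑ i : Fin 3, (0 - 0) * (0 - 0))) :=
      tendsto_finsetSum _ fun w _ => tendsto_finsetSum _ fun i _ =>
        ((hpt _).sub (hpt _)).mul ((hpt _).sub (hpt _))
    have h2 : Tendsto (fun k => ∑ m ∈ Finset.range n, (rhoSegment α m)⁻¹ *
        ∑ w : Fin m → Fin 3, ∑ i : Fin 3,
          dirichlet (along hα (f k - v) w i) (along hα (f k - v) w i)) atTop
        (𝓝 (∑ m ∈ Finset.range n, (rhoSegment α m)⁻¹ * ∑ w : Fin m → Fin 3, ∑ i : Fin 3, 0)) :=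
      tendsto_finsetSum _ fun m _ => (tendsto_finsetSum _ fun w _ =>
        tendsto_finsetSum _ fun i _ => (hlim m w i).2).const_mul _
    have h3 := (h1.const_mul (rhoDiscrete α n)⁻¹).add h2
    simp only [sub_self, mul_zero, Finset.sum_const_zero, add_zero] at h3
    exact h3
  -- Uniformity in the level: split f k - v at f l and let l tend to infinity with n fixed; `N`
  -- comes from the Cauchy condition alone.
  have hbound : ∀ ε > 0, ∃ N, ∀ k ≥ N, ∀ n, levelForm hα (f k - v) (f k - v) n ≤ ε := by
    intro ε hε
    obtain ⟨N, hN⟩ := hc (ε / 2) (half_pos hε)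
    refine ⟨N, fun k hk n => ?_⟩
    have h1 : Tendsto (fun l => ε + 2 * levelForm hα (f l - v) (f l - v) n) atTop (𝓝 ε) := by
      simpa using ((hlevel n).const_mul 2).const_add ε
    refine ge_of_tendsto h1 ?_
    filter_upwards [eventually_ge_atTop N] with l hl
    have h2 := levelForm_add_le hα (segmentwiseH1_sub hα (hf1 k) (hf1 l))
      (segmentwiseH1_sub hα (hf1 l) hv1) n
    rw [sub_add_sub_cancel] at h2
    have h3 := (levelForm_le_energy hα (hsub k l) n).trans (hN k hk l hl).le
    linarith
  have hmem : v ∈ domain hα := by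
    obtain ⟨N, hN⟩ := hbound 1 one_pos
    have h1 := mem_domain_of_le hα ((hf N).1.sub hv) (segmentwiseH1_sub hα (hf1 N) hv1)
      (hN N le_rfl)
    have h2 := sub_mem_domain hα (hf N) h1
    rwa [sub_sub_cancel] at h2
  refine ⟨hmem, ?_⟩
  rw [Metric.tendsto_atTop]
  intro ε hε
  obtain ⟨N, hN⟩ := hbound (ε / 2) (half_pos hε)
  refine ⟨N, fun n hn => ?_⟩
  have hm := sub_mem_domain hα (hf n) hmem
  rw [Real.dist_eq, sub_zero, abs_of_nonneg (energy_nonneg hα hm)]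
  exact (energy_le hα hm (hN n hn)).trans_lt (half_lt_self hε)

/-- Subtracting the values at a base point leaves energies unchanged, and the oscillation bound then
makes the sequence uniformly Cauchy. Its limit is continuous, so `mem_domain_of_tendsto` applies. -/
theorem form_complete (u : ℕ → attractor hα → ℝ) (hu : ∀ n, u n ∈ domain hα)
    (hc : ∀ ε > 0, ∃ N, ∀ m ≥ N, ∀ n ≥ N, √(form hα (u m - u n) (u m - u n)) < ε) :
    ∃ v ∈ domain hα, Tendsto (fun n => √(form hα (u n - v) (u n - v))) atTop (𝓝 0) := by
  set p : attractor hα := vertex hα (Fin.elim0 : Fin 0 → Fin 3) 0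
  have hsub := fun m n => sub_mem_domain hα (hu m) (hu n)
  let f : ℕ → attractor hα → ℝ := fun n => u n + fun _ => -u n p
  have hf : ∀ n, f n ∈ domain hα := fun n => add_mem_domain hα (hu n) (const_mem_domain hα _)
  have hfsub : ∀ m n, f m - f n = (u m - u n) + fun _ => -(u m - u n) p := by
    intro m n
    ext x
    simp only [f, Pi.sub_apply, Pi.add_apply]
    ring
  have hfe : ∀ m n, energy hα (f m - f n) = form hα (u m - u n) (u m - u n) := by
    intro m n
    rw [hfsub, energy_add_const hα (hsub m n), form_self hα (hsub m n)]
  let F : ℕ → C(attractor hα, ℝ) := fun n => ⟨f n, (hf n).1⟩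
  have hcau : CauchySeq F := by
    rw [Metric.cauchySeq_iff]
    intro ε hε
    -- The sup distance is at most 10 times the energy distance, hence below ε/2.
    obtain ⟨N, hN⟩ := hc (ε / 20) (by positivity)
    refine ⟨N, fun m hm n hn => ?_⟩
    refine lt_of_le_of_lt ((ContinuousMap.dist_le (half_pos hε).le).2 fun x => ?_)
      (half_lt_self hε)
    have h1 := Real.abs_le_sqrt (sq_sub_le_energy hα (hsub m n) x p)
    rw [← form_self hα (hsub m n), Real.sqrt_mul (by norm_num),
      show (100 : ℝ) = 10 ^ 2 by norm_num, Real.sqrt_sq (by norm_num)] at h1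
    have h2 : dist (F m x) (F n x) = |(u m - u n) x - (u m - u n) p| := by
      rw [Real.dist_eq]
      change |(f m - f n) x| = _
      rw [hfsub, Pi.add_apply, ← sub_eq_add_neg]
    rw [h2]
    linarith [hN m hm n hn]
  obtain ⟨v, hv⟩ := cauchySeq_tendsto_of_complete hcau
  have hpt : ∀ x, Tendsto (fun n => f n x) atTop (𝓝 (v x)) := fun x =>
    ((continuous_eval_const x).tendsto v).comp hv
  obtain ⟨hvm, hlim⟩ := mem_domain_of_tendsto hα hf v.continuous hpt fun ε hε => by
    obtain ⟨N, hN⟩ := hc (√ε) (Real.sqrt_pos.2 hε)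
    refine ⟨N, fun m hm n hn => ?_⟩
    rw [hfe]
    exact (Real.sqrt_lt_sqrt_iff_of_pos hε).1 (hN m hm n hn)
  refine ⟨v, hvm, ?_⟩
  have h := hlim.sqrt
  rw [Real.sqrt_zero] at h
  refine h.congr fun n => ?_
  have hm := sub_mem_domain hα (hu n) hvm
  have he : f n - ⇑v = (u n - ⇑v) + fun _ => -u n p := by
    ext x
    simp only [f, Pi.sub_apply, Pi.add_apply]
    ring
  rw [he, energy_add_const hα hm, form_self hα hm]

/-! ### The resistance form -/

theorem eq_const_of_energy_eq_zero (hu : u ∈ domain hα) (h : energy hα u = 0) :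
    ∃ c : ℝ, u = fun _ => c := by
  refine ⟨u (vertex hα (Fin.elim0 : Fin 0 → Fin 3) 0), funext fun x => ?_⟩
  have := sq_sub_le_energy hα hu x (vertex hα (Fin.elim0 : Fin 0 → Fin 3) 0)
  rw [h, mul_zero] at this
  exact sub_eq_zero.1 (pow_eq_zero_iff two_ne_zero |>.1 (le_antisymm this (sq_nonneg _)))

theorem energy_pos_of_ne (hu : u ∈ domain hα) {x y : attractor hα} (hxy : u x ≠ u y) :
    0 < energy hα u := by
  refine (energy_nonneg hα hu).lt_of_ne' fun h => ?_
  obtain ⟨c, rfl⟩ := eq_const_of_energy_eq_zero hα hu h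
  exact hxy rfl

theorem isResistanceForm : IsResistanceForm (domain hα) (form hα) where
  const_mem := const_mem_domain hα
  add_mem _ hu _ hv := add_mem_domain hα hu hv
  smul_mem c _ hu := smul_mem_domain hα c hu
  add_left u hu v hv w hw := by
    refine tendsto_nhds_unique (tendsto_levelForm_form hα (add_mem_domain hα hu hv) hw)
      (((tendsto_levelForm_form hα hu hw).add (tendsto_levelForm_form hα hv hw)).congr fun n => ?_)
    exact (levelForm_add_left hα (segmentwiseH1_of_mem_domain hα hu)
      (segmentwiseH1_of_mem_domain hα hv) (segmentwiseH1_of_mem_domain hα hw) n).symm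
  smul_left c u hu v hv := by
    refine tendsto_nhds_unique (tendsto_levelForm_form hα (smul_mem_domain hα c hu) hv)
      (((tendsto_levelForm_form hα hu hv).const_mul c).congr fun n => ?_)
    exact (levelForm_smul_left hα c u v n).symm
  symm u _ v _ := by
    rw [form, form, add_comm u v]
    ring
  nonneg u hu := by
    rw [form_self hα hu]
    exact energy_nonneg hα hu
  eq_zero_iff u hu := by
    rw [form_self hα hu]
    refine ⟨eq_const_of_energy_eq_zero hα hu, ?_⟩
    rintro ⟨c, rfl⟩
    exact energy_const hα c
  complete := form_complete hα
  separates x y hxy := exists_mem_domain_ne hα hxy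
  bddAbove x y := by
    refine ⟨100, ?_⟩
    rintro _ ⟨u, hu, hpos, rfl⟩
    rw [div_le_iff₀ hpos, sq_abs, form_self hα hu]
    exact sq_sub_le_energy hα hu x y
  markov u hu := by
    have h := comp_lipschitz_mem_domain hα hu
      ((LipschitzWith.id.max_const (0 : ℝ)).min_const (1 : ℝ))
    refine ⟨h.1, ?_⟩
    rw [form_self hα hu]
    exact (form_self hα h.1).trans_le h.2

/-! ### The resistance metric -/

/-- At level n the attractor is covered by finitely many closed cells and segments. Those missing
`x` also miss a neighbourhood of `x`, so a nearby `y` shares with `x` either a cell, of small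
oscillation, or a segment, where the Hölder bound applies. -/
theorem eventually_sq_sub_le (x : attractor hα) {ε : ℝ} (hε : 0 < ε) :
    ∀ᶠ y in 𝓝 x, ∀ u ∈ domain hα, (u x - u y) ^ 2 ≤ ε * energy hα u := by
  obtain ⟨n, hn⟩ : ∃ n : ℕ, 100 * (3 / 5 : ℝ) ^ n < ε := by
    have h : Tendsto (fun n : ℕ => 100 * (3 / 5 : ℝ) ^ n) atTop (𝓝 0) := by
      simpa using (tendsto_pow_atTop_nhds_zero_of_lt_one (r := (3 / 5 : ℝ)) (by norm_num)
        (by norm_num)).const_mul 100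
    exact (h.eventually (gt_mem_nhds hε)).exists
  have hcell : ∀ᶠ y : attractor hα in 𝓝 x, ∀ w : Fin n → Fin 3,
      (y : Plane) ∈ cell hα w → (x : Plane) ∈ cell hα w := by
    refine eventually_all.2 fun w => ?_
    by_cases hx : (x : Plane) ∈ cell hα w
    · exact Eventually.of_forall fun _ _ => hx
    · have hopen : IsOpen {y : attractor hα | (y : Plane) ∈ (cell hα w)ᶜ} :=
        (isCompact_cell hα w).isClosed.isOpen_compl.preimage continuous_subtype_val
      filter_upwards [hopen.mem_nhds hx] with y hy hy'
      exact absurd hy' hy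
  have hseg : ∀ᶠ y : attractor hα in 𝓝 x, ∀ (m : Fin n) (w : Fin m → Fin 3) (i : Fin 3),
      ∀ t ∈ Icc (0 : ℝ) 1, y = segmentPoint hα w i t →
      ∀ u ∈ domain hα, (u x - u y) ^ 2 ≤ ε * energy hα u := by
    refine eventually_all.2 fun m => eventually_all.2 fun w => eventually_all.2 fun i => ?_
    by_cases hx : x ∈ segmentPoint hα w i '' Icc (0 : ℝ) 1
    · obtain ⟨s, hs, rfl⟩ := hx
      set ℓ := ‖wordMap α w (segEnd α i) - wordMap α w (segStart α i)‖
      have hdist : ∀ t ∈ Icc (0 : ℝ) 1,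
          dist (segmentPoint hα w i t) (segmentPoint hα w i s) = |s - t| * ℓ := by
        intro t ht
        rw [Subtype.dist_eq, coe_segmentPoint hα w i ht, coe_segmentPoint hα w i hs, dist_eq_norm, path_sub, norm_smul, Real.norm_eq_abs,
          abs_sub_comm]
      -- A segment of length 0 would be a single point; treating this case avoids computing lengths.
      rcases (norm_nonneg _ : 0 ≤ ℓ).eq_or_lt with hℓ | hℓ
      · refine Eventually.of_forall fun y t ht hy u hu => ?_
        have := hdist t ht
        rw [show ℓ = 0 from hℓ.symm, mul_zero, dist_eq_zero] at this
        rw [hy, this, sub_self, zero_pow two_ne_zero]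
        exact mul_nonneg hε.le (energy_nonneg hα hu)
      · filter_upwards [ball_mem_nhds (segmentPoint hα w i s) (mul_pos hε hℓ)] with y hy t ht hyt u hu
        rw [mem_ball, hyt, hdist t ht] at hy
        rw [hyt]
        exact ((segmentwiseH1_of_mem_domain hα hu m w i).sq_sub_le ht hs).trans
          (mul_le_mul (lt_of_mul_lt_mul_right hy hℓ.le).le (dirichlet_along_le_energy hα hu w i)
            (dirichlet_nonneg _) hε.le)
    · have hcl : IsClosed (segmentPoint hα w i '' Icc (0 : ℝ) 1) :=
        (isCompact_Icc.image (lipschitz_segmentPoint hα w i).continuous).isClosed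
      filter_upwards [hcl.isOpen_compl.mem_nhds hx] with y hy t ht hyt
      exact absurd ⟨t, ht, hyt.symm⟩ hy
  filter_upwards [hcell, hseg] with y h1 h2 u hu
  rcases mem_cell_or_path hα n y.2 with ⟨w, hw⟩ | ⟨m, w, i, t, ht, hyt⟩
  · have hE := energy_nonneg hα hu
    refine (sq_sub_le_of_mem_cell hα hu.1 (segmentwiseH1_of_mem_domain hα hu)
      (levelForm_le_energy hα hu) (h1 w hw) hw).trans ?_
    rw [← mul_assoc]
    exact mul_le_mul_of_nonneg_right (by linarith [rhoDiscrete_le_pow hα n]) hE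
  · exact h2 m w i t ht (eq_segmentPoint hα ht hyt) u hu

theorem resistanceMetric_le {x y : attractor hα} {ε : ℝ} (hε : 0 ≤ ε)
    (h : ∀ u ∈ domain hα, (u x - u y) ^ 2 ≤ ε * energy hα u) :
    resistanceMetric (domain hα) (form hα) x y ≤ ε := by
  refine Real.sSup_le ?_ hε
  rintro _ ⟨u, hu, hpos, rfl⟩
  rw [div_le_iff₀ hpos, sq_abs, form_self hα hu]
  exact h u hu

theorem le_resistanceMetric (hu : u ∈ domain hα) (hpos : 0 < energy hα u) (x y : attractor hα) :
    (u x - u y) ^ 2 / energy hα u ≤ resistanceMetric (domain hα) (form hα) x y := by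
  refine le_csSup ((isResistanceForm hα).bddAbove x y) ⟨u, hu, ?_, ?_⟩
  · rwa [form_self hα hu]
  · rw [form_self hα hu, sq_abs]

/-- Near each `y` in `S`, a single function separating `x` from `y` keeps at least half its
quotient; compactness makes finitely many such bounds suffice. -/
theorem exists_pos_le_resistanceMetric {x : attractor hα} {S : Set (attractor hα)}
    (hS : IsCompact S) (hx : x ∉ S) :
    ∃ δ > 0, ∀ y ∈ S, δ ≤ resistanceMetric (domain hα) (form hα) x y := by
  refine hS.induction_on (p := fun S => ∃ δ > 0, ∀ y ∈ S,
    δ ≤ resistanceMetric (domain hα) (form hα) x y) ⟨1, one_pos, fun y hy => hy.elim⟩ ?_ ?_ ?_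
  · rintro S T hST ⟨δ, hδ, h⟩
    exact ⟨δ, hδ, fun y hy => h y (hST hy)⟩
  · rintro S T ⟨δ, hδ, h⟩ ⟨δ', hδ', h'⟩
    refine ⟨min δ δ', lt_min hδ hδ', fun y hy => ?_⟩
    rcases hy with hy | hy
    · exact (min_le_left _ _).trans (h y hy)
    · exact (min_le_right _ _).trans (h' y hy)
  · intro y hy
    have hxy : x ≠ y := fun h => hx (h ▸ hy)
    obtain ⟨u, hu, hne⟩ := exists_mem_domain_ne hα hxy
    have hE := energy_pos_of_ne hα hu hne
    have hpos : 0 < (u x - u y) ^ 2 / energy hα u := by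
      have := sub_ne_zero.2 hne
      positivity
    have hcont : Continuous fun z => (u x - u z) ^ 2 / energy hα u :=
      ((continuous_const.sub hu.1).pow 2).div_const _
    refine ⟨{z | (u x - u y) ^ 2 / energy hα u / 2 < (u x - u z) ^ 2 / energy hα u},
      mem_nhdsWithin_of_mem_nhds
        ((isOpen_lt continuous_const hcont).mem_nhds (half_lt_self hpos)), _, half_pos hpos,
      fun z hz => ?_⟩
    exact (le_of_lt hz).trans (le_resistanceMetric hα hu hE x z)

/-- One direction is the smallness of resistances near a point; the other applies the lower bound to
the compact complement of the open set. -/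
theorem resistanceTopology_eq : resistanceTopology (domain hα) (form hα) =
    (instTopologicalSpaceSubtype : TopologicalSpace (attractor hα)) := by
  refine TopologicalSpace.ext (funext fun U => propext ⟨fun hU => ?_, fun hU x hx => ?_⟩)
  · refine isOpen_iff_mem_nhds.2 fun x hx => ?_
    obtain ⟨ε, hε, h⟩ := hU x hx
    filter_upwards [eventually_sq_sub_le hα x (half_pos hε)] with y hy
    exact h y ((resistanceMetric_le hα (half_pos hε).le hy).trans_lt (half_lt_self hε))
  · have hU' : IsOpen U := hU
    obtain ⟨δ, hδ, h⟩ := exists_pos_le_resistanceMetric hα hU'.isClosed_compl.isCompact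
      (not_not_intro hx : x ∉ Uᶜ)
    exact ⟨δ, hδ, fun y hy => not_not.1 fun hyU => (h y hyU).not_gt hy⟩

theorem mem_resistanceC0_iff (f : attractor hα → ℝ) :
    f ∈ resistanceC0 (domain hα) (form hα) ↔ Continuous f := by
  -- Generalising the topology lets the equality be substituted inside `Continuous` and
  -- `HasCompactSupport`.
  have h : ∀ t : TopologicalSpace (attractor hα), t = instTopologicalSpaceSubtype →
      ((@Continuous _ _ t _ f ∧ @HasCompactSupport _ _ t _ f) ↔
        @Continuous _ _ instTopologicalSpaceSubtype _ f) := by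
    rintro t rfl
    exact and_iff_left (HasCompactSupport.of_compactSpace f)
  exact h _ (resistanceTopology_eq hα)

/-! ### Regularity -/

/-- u ⊔ v = u + (v - u)⁺, and the positive part is 1-Lipschitz. -/
theorem sup_mem_domain (hu : u ∈ domain hα) (hv : v ∈ domain hα) : u ⊔ v ∈ domain hα := by
  have h := add_mem_domain hα hu (comp_lipschitz_mem_domain hα (sub_mem_domain hα hv hu)
    (LipschitzWith.id.max_const (0 : ℝ))).1
  convert h using 1
  ext x
  simp only [Pi.sup_apply, Pi.add_apply, Function.comp_apply, Pi.sub_apply, id]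
  rw [← max_add_add_left, add_sub_cancel, add_zero, max_comm]

theorem inf_mem_domain (hu : u ∈ domain hα) (hv : v ∈ domain hα) : u ⊓ v ∈ domain hα := by
  have h := sub_mem_domain hα (add_mem_domain hα hu hv) (sup_mem_domain hα hu hv)
  convert h using 1
  ext x
  simp only [Pi.inf_apply, Pi.sub_apply, Pi.add_apply, Pi.sup_apply]
  linarith [min_add_max (u x) (v x)]

/-- Lattice Stone–Weierstrass: it suffices to match prescribed values at two points, which an affine
function of a separating `u` does. -/
theorem isRegularForm : IsRegularForm (domain hα) (form hα) := by
  intro f hf ε hε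
  rw [mem_resistanceC0_iff] at hf
  let L : Set C(attractor hα, ℝ) := {g | ⇑g ∈ domain hα}
  have hL : closure L = ⊤ := by
    refine ContinuousMap.sublattice_closure_eq_top L
      ⟨ContinuousMap.const _ 0, const_mem_domain hα 0⟩
      (fun g hg h hh => inf_mem_domain hα hg hh) (fun g hg h hh => sup_mem_domain hα hg hh) ?_
    intro g x y
    by_cases hxy : x = y
    · subst hxy
      exact ⟨ContinuousMap.const _ (g x), const_mem_domain hα _, rfl, rfl⟩
    obtain ⟨u, hu, hne⟩ := exists_mem_domain_ne hα hxy
    have hmem := add_mem_domain hα (smul_mem_domain hα ((g x - g y) / (u x - u y)) hu)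
      (const_mem_domain hα (g x - (g x - g y) / (u x - u y) * u x))
    refine ⟨⟨_, hmem.1⟩, hmem, ?_, ?_⟩
    · simp
    · have := sub_ne_zero.2 hne
      simp only [ContinuousMap.coe_mk, Pi.add_apply, Pi.smul_apply, smul_eq_mul]
      field_simp
      ring
  have hfm : (⟨f, hf⟩ : C(attractor hα, ℝ)) ∈ closure L := hL ▸ mem_univ _
  obtain ⟨g, hg, hfg⟩ := Metric.mem_closure_iff.1 hfm ε hε
  refine ⟨g, ⟨hg, (mem_resistanceC0_iff hα g).2 g.continuous⟩, fun x => ?_⟩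
  exact (ContinuousMap.dist_apply_le_dist x).trans_lt hfg

end Energy

end Hanoi

theorem mainTheorem6 (α : ℝ) (hα : α ∈ Set.Ioo (0 : ℝ) (1 / 3)) :
    IsResistanceForm (Hanoi.domain hα) (Hanoi.form hα) ∧
    resistanceTopology (Hanoi.domain hα) (Hanoi.form hα) =
      (instTopologicalSpaceSubtype : TopologicalSpace (Hanoi.attractor hα)) ∧
    @CompactSpace (Hanoi.attractor hα)
      (resistanceTopology (Hanoi.domain hα) (Hanoi.form hα)) ∧
    IsRegularForm (Hanoi.domain hα) (Hanoi.form hα) := by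
  refine ⟨Hanoi.isResistanceForm hα, Hanoi.resistanceTopology_eq hα, ?_, Hanoi.isRegularForm hα⟩
  rw [Hanoi.resistanceTopology_eq hα]
  exact Hanoi.compactSpace_attractor hα
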